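/- Let $\alpha>0$, let $F$ be a continuous distribution function on $\mathbb R$ with $F(0)=0$, and let $U(t)=\inf\{x: F(x)\ge 1-1/t\}$ for $t>1$. Assume that $$\lim_{t\to\infty}\frac{U(tx)}{U(t)}=x^{1/\alpha}\quad\text{for all }x>0,$$ and that there are $t_0>1$ and $\eta\in[0,1)$ such that $$\frac{U(tx)}{U(t)}\ \ge\ (1-\eta)\,x^{1/\alpha}+\eta\quad\text{for all }t\ge t_0,\ x\ge 1 .$$ For every $n$ let $W_1,\dots,W_n$ be i.i.d. with distribution function $F$, let $W_{(1)}(n)\ge\dots\ge W_{(n)}(n)$ be their decreasing order statistics, and let $L(n)=\sum_{i=1}^n W_i$. Let $A(n)=(A_{ij}(n))_{i,j=1}^n$ be a symmetric random matrix with entries in $\{0,1,2,\dots\}$ such that one of the following holds: (a) (Norros–Reittu) for every $n$, conditionally on $(W_{(i)}(n))_{i\le n}$, the entries $A_{ij}(n)$, $1\le i\le j\le n$, are independent and $A_{ij}(n)$ is Poisson with mean $W_{(i)}(n)W_{(j)}(n)/L(n)$; (b) (Chung–Lu) $\alpha>2$ and, for every $n$, conditionally on $(W_{(i)}(n))_{i\le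 n}$, the entries $A_{ij}(n)$, $1\le i\le j\le n$, are independent and $A_{ij}(n)$ is Bernoulli with success probability $\min\{W_{(i)}(n)W_{(j)}(n)/L(n),\,1\}$. Let $D_i(n)=\sum_{j=1}^n A_{ij}(n)$ be the degree of node $i$ (the node with the $i$-th largest weight) and let $R_i(n)=\#\{j\le n: D_j(n)\ge D_i(n)\}$. If $k(n)$ are nonnegative integers with $$k(n)\to\infty\qquad\text{and}\qquad \frac{k(n)\,\log^{\alpha}(n)}{n^{1/(4\alpha+1)}}\to 0\qquad(n\to\infty),$$ then $$\mathbb P\bigl((R_1(n),R_2(n),\dots,R_{k(n)}(n))=(1,2,\dots,k(n))\bigr)\to 1\qquad(n\to\infty).$$ (On this event the $k(n)$ nodes of largest weight have, in the same order and without ties, the $k(n)$ largest degrees.) -/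

import Mathlib

open MeasureTheory ProbabilityTheory Filter
open scoped Topology ProbabilityTheory

noncomputable section

/-- The generalized inverse `F^←(y) = inf {x : F x ≥ y}`. -/
def genInv (F : ℝ → ℝ) (y : ℝ) : ℝ :=
  sInf {x : ℝ | y ≤ F x}

/-- The tail quantile function `U(t) = F^←(1 - 1/t)` of the law `ν` with distribution function `F`.
Only its values at `t > 1` are meaningful (there the infimum is over a nonempty set which is
bounded below). -/
def tailQuantile (ν : Measure ℝ) (t : ℝ) : ℝ :=
  genInv (cdf ν) (1 - 1 / t)

/-- Regular variation of `U` at infinity with index `1 / α`. -/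
def QuantileRegVar (U : ℝ → ℝ) (α : ℝ) : Prop :=
  ∀ x : ℝ, 0 < x → Tendsto (fun t => U (t * x) / U t) atTop (𝓝 (x ^ (1 / α)))

/-- The lower bound `U(tx)/U(t) ≥ (1 - η) x^{1/α} + η` for all large `t` and all `x ≥ 1`.
The condition `1 < t` keeps `t` inside the range where `U` is meaningful. -/
def QuantileLower (U : ℝ → ℝ) (α : ℝ) : Prop :=
  ∃ t₀ : ℝ, 0 < t₀ ∧ ∃ η : ℝ, 0 ≤ η ∧ η < 1 ∧
    ∀ t : ℝ, t₀ ≤ t → 1 < t → ∀ x : ℝ, 1 ≤ x →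
      (1 - η) * x ^ (1 / α) + η ≤ U (t * x) / U t

/-- The decreasing order statistics `w_(1) ≥ w_(2) ≥ ... ≥ w_(n)`; the index is 0-based, so that
`decOrder w i` is the `(i + 1)`-st largest entry of `w`. -/
def decOrder {n : ℕ} (w : Fin n → ℝ) : Fin n → ℝ :=
  fun i => w (Tuple.sort w i.rev)

/-- `w_i w_j / L` with `L = w_1 + ... + w_n`. -/
def edgeRate {n : ℕ} (w : Fin n → ℝ) (i j : Fin n) : ℝ :=
  w i * w j / ∑ l, w l

/-- `W_1, ..., W_n` are independent with common law `ν`. -/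
structure IsIIDWeights {Ω : Type*} [MeasurableSpace Ω] {n : ℕ}
    (P : Measure Ω) (ν : Measure ℝ) (W : Fin n → Ω → ℝ) : Prop where
  measurable : ∀ i, Measurable (W i)
  law : ∀ i, P.map (W i) = ν
  indep : iIndepFun W P

/-- The symmetric array `A` of random edge counts on the nodes `1, ..., n` is an ordered
inhomogeneous random network with weights `W`: conditionally on the decreasing order statistics
`W_(1), ..., W_(n)`, the entries `A i j`, `i ≤ j`, are independent and `A i j` has law
`edgeLaw (W_(i) W_(j) / L)`. -/
structure IsOrderedNetwork (edgeLaw : ℝ → Measure ℕ) {Ω : Type*} [MeasurableSpace Ω] {n : ℕ}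
    (P : Measure Ω) (W : Fin n → Ω → ℝ) (A : Fin n → Fin n → Ω → ℕ) : Prop where
  measurable : ∀ i j, Measurable (A i j)
  symm : ∀ i j, A i j = A j i
  condLaw : ∀ a : Fin n → Fin n → ℕ,
    P⟦{ω | ∀ i j, i ≤ j → A i j ω = a i j} |
        MeasurableSpace.comap (fun ω => decOrder (fun l => W l ω)) inferInstance⟧
      =ᵐ[P] fun ω => ∏ i, ∏ j ∈ Finset.Ici i,
        (edgeLaw (edgeRate (decOrder (fun l => W l ω)) i j)).real {a i j}

/-- The Norros--Reittu multigraph: Poisson edge counts with the given rates. -/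
def IsNorrosReittu {Ω : Type*} [MeasurableSpace Ω] {n : ℕ}
    (P : Measure Ω) (W : Fin n → Ω → ℝ) (A : Fin n → Fin n → Ω → ℕ) : Prop :=
  IsOrderedNetwork (fun r => poissonMeasure r.toNNReal) P W A

/-- The Chung--Lu graph: the edge indicator is `1` with probability `r ∧ 1`, else `0`
(for a rate `r ≥ 0`, the projection of `r` to `[0, 1]` is `r ∧ 1`). -/
def IsChungLu {Ω : Type*} [MeasurableSpace Ω] {n : ℕ}
    (P : Measure Ω) (W : Fin n → Ω → ℝ) (A : Fin n → Fin n → Ω → ℕ) : Prop :=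
  IsOrderedNetwork
    (fun r => bernoulliMeasure (1 : ℕ) 0 (Set.projIcc (0 : ℝ) 1 zero_le_one r)) P W A

/-- The degree `D_i = ∑_j A_ij` of node `i`. -/
def netDegree {Ω : Type*} {n : ℕ} (A : Fin n → Fin n → Ω → ℕ) (i : Fin n) (ω : Ω) : ℕ :=
  ∑ j, A i j ω

/-- `R_i`, the number of nodes whose degree is at least the degree of node `i`. -/
def degreeRank {Ω : Type*} {n : ℕ} (A : Fin n → Fin n → Ω → ℕ) (i : Fin n) (ω : Ω) : ℕ :=
  ∑ j, if netDegree A i ω ≤ netDegree A j ω then 1 else 0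

end

/-! Conditionally on the ordered weights `w`, the degree of node `i` is a sum of independent edge
counts whose rates add up to `w i`, so its exponential moments are at most those of a Poisson
variable of mean `w i`. If `w j ≤ (1 - s) * w i`, cutting at the midpoint of the two weights and
applying Chernoff to each degree shows that `j` catches up with `i` with probability at most `2 *
exp (-s² * w i / 16)` (`measure_le_compare`). A union bound over pairs leaves two tasks: the top `k`
weights must be large, and each must be separated from all smaller ones.

Both are read off on the scale of the tail `T = 1 - F`. As `F` is continuous, `T(W)` is uniform.
With `v = 4k/n`, the top `k` points satisfy `T ≤ v` except with probability `exp (-k/2)`, and some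
point with `T ≤ v` has another one within a factor `1 + δ` above it with probability at most `n² δ
v² = 16 k² δ`. The choice `δ = 1/(k² log^α n)` makes this vanish. The lower bound on `U` turns a
factor `1 + δ` in `T` into a factor `1 - cδ` in the weights, and `T ≤ v` into `w ≥ c (1/v)^(1/α)`
(`exists_quantile_constants`). The Chernoff exponent is then of order `δ² (n/k)^(1/α)`, and the
growth condition on `k` makes it exceed `3 log n`, which beats the `n²` pairs.

For Chung–Lu the lower tail needs a mean that is not reduced by truncation at 1. When `α > 2`,
`U(t)² / t → 0`, so with high probability no rate exceeds 1. -/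

noncomputable section

/-! ### Sub-Poisson variables and Chernoff bounds -/

/-- All exponential moments of `X` are dominated by those of a Poisson variable of mean `r`. -/
structure HasSubPoissonMGF {Ω : Type*} [MeasurableSpace Ω] (X : Ω → ℝ) (μ : Measure Ω)
    (r : ℝ) : Prop where
  integrable : ∀ t : ℝ, Integrable (fun ω => Real.exp (t * X ω)) μ
  mgf_le : ∀ t : ℝ, mgf X μ t ≤ Real.exp (r * (Real.exp t - 1))

namespace HasSubPoissonMGF

variable {Ω : Type*} [MeasurableSpace Ω] {μ : Measure Ω} {X Y : Ω → ℝ} {a b : ℝ}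

lemma sum {ι : Type*} [Fintype ι] [IsProbabilityMeasure μ] {X : ι → Ω → ℝ} {r : ι → ℝ}
    (hX : iIndepFun X μ) (hm : ∀ i, Measurable (X i))
    (h : ∀ i, HasSubPoissonMGF (X i) μ (r i)) :
    HasSubPoissonMGF (fun ω => ∑ i, X i ω) μ (∑ i, r i) where
  integrable t := by
    have := hX.integrable_exp_mul_sum (t := t) (s := Finset.univ) hm
      (fun i _ => (h i).integrable t)
    simpa [Finset.sum_apply] using this
  mgf_le t := by
    have h1 : (fun ω => ∑ i, X i ω) = ∑ i, X i := by ext; simp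
    rw [h1, hX.mgf_sum hm, Finset.sum_mul, Real.exp_sum]
    exact Finset.prod_le_prod (fun _ _ => mgf_nonneg) (fun i _ => (h i).mgf_le t)

lemma measure_ge_le [IsFiniteMeasure μ] (h : HasSubPoissonMGF X μ a) (ha : 0 ≤ a) {t : ℝ}
    (ht : 0 ≤ t) (ht1 : t ≤ 1) (m : ℝ) :
    μ.real {ω | m ≤ X ω} ≤ Real.exp (a * (t + t ^ 2) - t * m) := by
  refine (measure_ge_le_exp_mul_mgf m ht (h.integrable t)).trans ?_
  refine (mul_le_mul_of_nonneg_left (h.mgf_le t) (Real.exp_pos _).le).trans ?_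
  rw [← Real.exp_add, Real.exp_le_exp]
  have := (abs_le.1 (Real.abs_exp_sub_one_sub_id_le (x := t) (abs_le.2 ⟨by linarith, ht1⟩))).2
  nlinarith [mul_le_mul_of_nonneg_left this ha]

lemma measure_le_le [IsFiniteMeasure μ] (h : HasSubPoissonMGF X μ a) (ha : 0 ≤ a) {t : ℝ}
    (ht : 0 ≤ t) (ht1 : t ≤ 1) (m : ℝ) :
    μ.real {ω | X ω ≤ m} ≤ Real.exp (a * (-t + t ^ 2) + t * m) := by
  refine (measure_le_le_exp_mul_mgf m (neg_nonpos.2 ht) (h.integrable (-t))).trans ?_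
  refine (mul_le_mul_of_nonneg_left (h.mgf_le (-t)) (Real.exp_pos _).le).trans ?_
  rw [← Real.exp_add, Real.exp_le_exp]
  have := (abs_le.1 (Real.abs_exp_sub_one_sub_id_le (x := -t)
    (abs_le.2 ⟨by linarith, by linarith⟩))).2
  nlinarith [mul_le_mul_of_nonneg_left this ha]

/-- If `X ≤ Y`, one of the two is on the wrong side of `(a + b) / 2`. With `t = s / 4` each exponent
is at most `-s (a - b) / 8 + s² a / 16`, and `a - b ≥ s a`. Independence of `X` and `Y` is not
needed, which matters because two degrees share an edge count. -/
lemma measure_le_compare [IsFiniteMeasure μ] (hX : HasSubPoissonMGF X μ a)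
    (hY : HasSubPoissonMGF Y μ b) (ha : 0 ≤ a) (hb : 0 ≤ b) {s : ℝ} (hs : 0 ≤ s) (hs1 : s ≤ 1)
    (hab : b ≤ (1 - s) * a) :
    μ.real {ω | X ω ≤ Y ω} ≤ 2 * Real.exp (-(s ^ 2 * a / 16)) := by
  have hsub : {ω | X ω ≤ Y ω} ⊆ {ω | X ω ≤ (a + b) / 2} ∪ {ω | (a + b) / 2 ≤ Y ω} := by
    intro ω hω
    rcases le_total (X ω) ((a + b) / 2) with h | h
    · exact Or.inl h
    · exact Or.inr (h.trans hω)
  have hba : b ≤ a := hab.trans (by nlinarith)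
  have h1 := hX.measure_le_le ha (t := s / 4) (by linarith) (by linarith) ((a + b) / 2)
  have h2 := hY.measure_ge_le hb (t := s / 4) (by linarith) (by linarith) ((a + b) / 2)
  have key : s * (a - b) ≥ s * (s * a) := mul_le_mul_of_nonneg_left (by linarith) hs
  have h3 : b * s ^ 2 ≤ a * s ^ 2 := mul_le_mul_of_nonneg_right hba (sq_nonneg s)
  have e1 : Real.exp (a * (-(s / 4) + (s / 4) ^ 2) + s / 4 * ((a + b) / 2)) ≤
      Real.exp (-(s ^ 2 * a / 16)) := by
    rw [Real.exp_le_exp]; nlinarith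
  have e2 : Real.exp (b * (s / 4 + (s / 4) ^ 2) - s / 4 * ((a + b) / 2)) ≤
      Real.exp (-(s ^ 2 * a / 16)) := by
    rw [Real.exp_le_exp]; nlinarith
  calc μ.real {ω | X ω ≤ Y ω} ≤ _ := measureReal_mono hsub
    _ ≤ _ := measureReal_union_le _ _
    _ ≤ _ := by linarith

/-- The moment generating function is exactly `1 + p (exp t - 1)`, and `1 + x ≤ exp x` holds for
both signs of `t`. -/
lemma indicator [IsProbabilityMeasure μ] {B : Set Ω} (hB : MeasurableSet B) :
    HasSubPoissonMGF (B.indicator 1) μ (μ.real B) := by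
  have h1 : ∀ t : ℝ, (fun ω => Real.exp (t * B.indicator 1 ω)) =
      fun ω => 1 + B.indicator (fun _ => Real.exp t - 1) ω := by
    intro t; ext ω
    by_cases h : ω ∈ B <;> simp [h]
  refine ⟨fun t => ?_, fun t => ?_⟩
  · rw [h1]
    exact (integrable_const _).add ((integrable_const _).indicator hB)
  · rw [mgf, h1, integral_add (integrable_const _) ((integrable_const _).indicator hB),
      integral_indicator_const _ hB]
    simp only [integral_const, probReal_univ, smul_eq_mul]
    linarith [Real.add_one_le_exp (μ.real B * (Real.exp t - 1))]

lemma of_map {Ω' : Type*} [MeasurableSpace Ω'] {g : Ω' → Ω} {μ' : Measure Ω'}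
    (hg : MeasurePreserving g μ' μ) (hX : Measurable X) (h : HasSubPoissonMGF X μ a) :
    HasSubPoissonMGF (X ∘ g) μ' a := by
  refine ⟨fun t => ?_, fun t => ?_⟩
  · have := h.integrable t
    exact hg.integrable_comp_of_integrable this
  · have := h.mgf_le t
    rw [mgf, ← hg.map_eq, integral_map hg.measurable.aemeasurable] at this
    · exact this
    · fun_prop

lemma mono (h : HasSubPoissonMGF X μ a) (hab : a = b) : HasSubPoissonMGF X μ b := hab ▸ h

end HasSubPoissonMGF

lemma hasSubPoissonMGF_poissonMeasure (r : NNReal) :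
    HasSubPoissonMGF (fun m : ℕ => (m : ℝ)) (poissonMeasure r) r := by
  have hs : ∀ t : ℝ, HasSum (fun m : ℕ => (Real.exp (-r) * r ^ m / m.factorial) * Real.exp (t * m))
      (Real.exp (r * (Real.exp t - 1))) := by
    intro t
    have h := (NormedSpace.expSeries_div_hasSum_exp (r * Real.exp t : ℝ)).mul_left
      (Real.exp (-r))
    rw [← Real.exp_eq_exp_ℝ, ← Real.exp_add] at h
    have e : (fun m : ℕ => (Real.exp (-r) * r ^ m / m.factorial) * Real.exp (t * m)) =
        fun m : ℕ => Real.exp (-r) * ((r * Real.exp t) ^ m / m.factorial) := by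
      ext m
      rw [mul_comm t, Real.exp_nat_mul, mul_pow]; ring
    rw [e, show (r : ℝ) * (Real.exp t - 1) = -r + r * Real.exp t by ring]
    exact h
  refine ⟨fun t => ?_, fun t => ?_⟩
  · rw [integrable_poissonMeasure_iff]
    simpa using (hs t).summable
  · rw [mgf, integral_poissonMeasure]
    exact ((hs t).tsum_eq).le

lemma hasSubPoissonMGF_bernoulliMeasure (p : unitInterval) :
    HasSubPoissonMGF (fun m : ℕ => (m : ℝ)) (bernoulliMeasure (1 : ℕ) 0 p) p := by
  have h : HasSubPoissonMGF (({1} : Set ℕ).indicator 1) (bernoulliMeasure (1 : ℕ) 0 p)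
      ((bernoulliMeasure (1 : ℕ) 0 p).real {1}) :=
    HasSubPoissonMGF.indicator (MeasurableSet.singleton _)
  rw [bernoulliMeasure_real_apply_of_mem_of_notMem p (by simp) (by simp) (by simp)] at h
  have hae : ∀ t : ℝ, (fun m : ℕ => Real.exp (t * ({1} : Set ℕ).indicator 1 m)) =ᵐ[
      bernoulliMeasure (1 : ℕ) 0 p] fun m => Real.exp (t * m) := by
    intro t
    rw [bernoulliMeasure_def, Filter.EventuallyEq, ae_iff]
    simp
  exact ⟨fun t => (h.integrable t).congr (hae t), fun t => by
    rw [mgf, ← integral_congr_ae (hae t)]; exact h.mgf_le t⟩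

/-! ### Order statistics and degrees under the conditional law -/

/-- The finitely many fibres of `Tuple.sort` are cut out by inequalities and tie-breaking conditions
between coordinates; on each of them an order statistic is a fixed coordinate. -/
lemma measurable_decOrder {n : ℕ} : Measurable (decOrder : (Fin n → ℝ) → Fin n → ℝ) := by
  have hs : ∀ σ : Equiv.Perm (Fin n), MeasurableSet {w : Fin n → ℝ | Tuple.sort w = σ} := by
    intro σ
    have : {w : Fin n → ℝ | Tuple.sort w = σ} =
        {w | (∀ i j, i ≤ j → w (σ i) ≤ w (σ j)) ∧
          ∀ i j, i < j → w (σ i) = w (σ j) → σ i < σ j} := by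
      ext w
      rw [Set.mem_ofPred_eq, eq_comm, Tuple.eq_sort_iff]
      rfl
    rw [this, measurableSet_setOfPred]
    refine .and (.forall fun i => .forall fun j => .imp (by fun_prop) ?_)
      (.forall fun i => .forall fun j => .imp (by fun_prop) (.imp ?_ (by fun_prop)))
    · exact measurableSet_setOfPred.1 (measurableSet_le (by fun_prop) (by fun_prop))
    · exact measurableSet_setOfPred.1 (measurableSet_eq_fun (by fun_prop) (by fun_prop))
  refine measurable_pi_lambda _ fun i s hs' => ?_
  have : (fun w : Fin n → ℝ => decOrder w i) ⁻¹' s =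
      ⋃ σ : Equiv.Perm (Fin n), {w | Tuple.sort w = σ} ∩ (fun w => w (σ i.rev)) ⁻¹' s := by
    ext w
    simp [decOrder]
  rw [this]
  exact .iUnion fun σ => (hs σ).inter ((measurable_pi_apply _) hs')

/-- The pairs `i ≤ j` of nodes. -/
abbrev NodePair (n : ℕ) : Type := {p : Fin n × Fin n // p.1 ≤ p.2}

/-- The unordered pair of two nodes. -/
def nodePair {n : ℕ} (i j : Fin n) : NodePair n := ⟨(min i j, max i j), min_le_max⟩

/-- Distinct neighbours use distinct pairs, so the summands of one degree are independent. -/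
lemma nodePair_injective {n : ℕ} (i : Fin n) : Function.Injective (nodePair i) := by
  intro j l h
  simp only [nodePair, Subtype.mk.injEq, Prod.mk.injEq] at h
  obtain ⟨h1, h2⟩ := h
  grind

/-- The law of the independent edge counts of a network with ordered weights `w`. -/
def netLaw (edgeLaw : ℝ → Measure ℕ) {n : ℕ} (w : Fin n → ℝ) : Measure (NodePair n → ℕ) :=
  Measure.pi fun p => edgeLaw (edgeRate w p.1.1 p.1.2)

instance (edgeLaw : ℝ → Measure ℕ) [∀ r, IsProbabilityMeasure (edgeLaw r)] {n : ℕ}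
    (w : Fin n → ℝ) : IsProbabilityMeasure (netLaw edgeLaw w) := by
  unfold netLaw; infer_instance

/-- The degree of node `i` in terms of the edge counts of the unordered pairs. -/
def pairDegree {n : ℕ} (a : NodePair n → ℕ) (i : Fin n) : ℕ := ∑ j, a (nodePair i j)

lemma edgeRate_comm {n : ℕ} (w : Fin n → ℝ) (i j : Fin n) : edgeRate w i j = edgeRate w j i := by
  rw [edgeRate, edgeRate, mul_comm (w i)]

lemma sum_edgeRate {n : ℕ} {w : Fin n → ℝ} (hw : ∑ l, w l ≠ 0) (i : Fin n) :
    ∑ j, edgeRate w i j = w i := by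
  simp only [edgeRate]
  rw [← Finset.sum_div, ← Finset.mul_sum, mul_div_cancel_right₀ _ hw]

lemma edgeRate_nodePair {n : ℕ} (w : Fin n → ℝ) (i j : Fin n) :
    edgeRate w (nodePair i j).1.1 (nodePair i j).1.2 = edgeRate w i j := by
  rcases le_total i j with h | h
  · simp [nodePair, h]
  · simp [nodePair, h, edgeRate_comm w i j]

/-- The loop at `i` is counted once, so the rates in row `i` add up to exactly `w i`. -/
lemma hasSubPoissonMGF_pairDegree {edgeLaw : ℝ → Measure ℕ} [∀ r, IsProbabilityMeasure (edgeLaw r)]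
    {n : ℕ} {w : Fin n → ℝ} (hw : ∑ l, w l ≠ 0)
    (h : ∀ i j, HasSubPoissonMGF (fun m : ℕ => (m : ℝ)) (edgeLaw (edgeRate w i j))
      (edgeRate w i j)) (i : Fin n) :
    HasSubPoissonMGF (fun a : NodePair n → ℕ => (pairDegree a i : ℝ)) (netLaw edgeLaw w) (w i) := by
  have hind : iIndepFun (fun p (a : NodePair n → ℕ) => (a p : ℝ)) (netLaw edgeLaw w) :=
    iIndepFun_pi (μ := fun p : NodePair n => edgeLaw (edgeRate w p.1.1 p.1.2))
      (X := fun _ (m : ℕ) => (m : ℝ)) fun _ => by fun_prop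
  have h2 := HasSubPoissonMGF.sum (hind.precomp (nodePair_injective i)) (fun j => by fun_prop)
    (r := fun j => edgeRate w i j) fun j => by
      have := h (nodePair i j).1.1 (nodePair i j).1.2
      have h3 := HasSubPoissonMGF.of_map (measurePreserving_eval
        (fun p : NodePair n => edgeLaw (edgeRate w p.1.1 p.1.2)) (nodePair i j)) (by fun_prop) this
      exact h3.mono (edgeRate_nodePair w i j)
  rw [sum_edgeRate hw] at h2
  simpa [pairDegree] using h2

/-- The edge counts in which one of the first `k` nodes does not beat all later nodes. -/
def misranked (n k : ℕ) : Set (NodePair n → ℕ) :=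
  {a | ∃ i j : Fin n, (i : ℕ) < k ∧ i < j ∧ pairDegree a i ≤ pairDegree a j}

lemma netLaw_misranked_le {edgeLaw : ℝ → Measure ℕ} [∀ r, IsProbabilityMeasure (edgeLaw r)]
    {n k : ℕ} {w : Fin n → ℝ} (hw : ∀ i, 0 < w i)
    (h : ∀ i j, HasSubPoissonMGF (fun m : ℕ => (m : ℝ)) (edgeLaw (edgeRate w i j))
      (edgeRate w i j)) {s b : ℝ} (hs : 0 ≤ s) (hs1 : s ≤ 1)
    (hgap : ∀ i j : Fin n, (i : ℕ) < k → i < j → w j ≤ (1 - s) * w i)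
    (hlow : ∀ i : Fin n, (i : ℕ) < k → b ≤ w i) :
    (netLaw edgeLaw w).real (misranked n k) ≤ 2 * n ^ 2 * Real.exp (-(s ^ 2 * b / 16)) := by
  have hsub : misranked n k ⊆ ⋃ p : Fin n × Fin n,
      {a | (p.1 : ℕ) < k ∧ p.1 < p.2 ∧ pairDegree a p.1 ≤ pairDegree a p.2} := by
    rintro a ⟨i, j, h⟩
    exact Set.mem_iUnion.2 ⟨(i, j), h⟩
  refine (measureReal_mono hsub).trans ((measureReal_iUnion_fintype_le _).trans ?_)
  have hp : ∀ p : Fin n × Fin n, (netLaw edgeLaw w).real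
      {a | (p.1 : ℕ) < k ∧ p.1 < p.2 ∧ pairDegree a p.1 ≤ pairDegree a p.2} ≤
      2 * Real.exp (-(s ^ 2 * b / 16)) := by
    rintro ⟨i, j⟩
    by_cases hc : (i : ℕ) < k ∧ i < j
    · have hpos : ∑ l, w l ≠ 0 := (Finset.sum_pos (fun l _ => hw l) ⟨i, Finset.mem_univ _⟩).ne'
      have h1 := HasSubPoissonMGF.measure_le_compare (hasSubPoissonMGF_pairDegree hpos h i)
        (hasSubPoissonMGF_pairDegree hpos h j) (hw i).le (hw j).le hs hs1 (hgap i j hc.1 hc.2)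
      refine (measureReal_mono ?_).trans (h1.trans ?_)
      · rintro a ⟨_, _, h⟩
        exact_mod_cast h
      · have := hlow i hc.1
        gcongr
    · have : {a : NodePair n → ℕ | (i : ℕ) < k ∧ i < j ∧ pairDegree a i ≤ pairDegree a j} = ∅ := by
        ext a; simp only [Set.mem_ofPred_eq, Set.mem_empty_iff_false, iff_false]; tauto
      simp only [this, measureReal_empty]
      positivity
  refine (Finset.sum_le_sum fun p _ => hp p).trans (le_of_eq ?_)
  simp; ring

/-! ### From the conditional law to the network -/

namespace IsOrderedNetwork

variable {edgeLaw : ℝ → Measure ℕ} {Ω : Type*} [MeasurableSpace Ω] {n : ℕ} {P : Measure Ω}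
  {W : Fin n → Ω → ℝ} {A : Fin n → Fin n → Ω → ℕ}

lemma netDegree_eq (h : IsOrderedNetwork edgeLaw P W A) (i : Fin n) (ω : Ω) :
    netDegree A i ω = pairDegree (fun p : NodePair n => A p.1.1 p.1.2 ω) i := by
  refine Finset.sum_congr rfl fun j _ => ?_
  rcases le_total i j with hij | hij
  · simp [nodePair, hij]
  · simp [nodePair, hij, h.symm i j]

/-- Off the misranked set, the nodes whose degree is at least that of `i` are exactly those `j ≤ i`;
with indices from 0 there are `i + 1` of them. -/
lemma degreeRank_eq (h : IsOrderedNetwork edgeLaw P W A) {k : ℕ} {ω : Ω}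
    (hω : (fun p : NodePair n => A p.1.1 p.1.2 ω) ∉ misranked n k) (i : Fin n) (hi : (i : ℕ) < k) :
    degreeRank A i ω = (i : ℕ) + 1 := by
  have hlt : ∀ i j : Fin n, (i : ℕ) < k → i < j → netDegree A j ω < netDegree A i ω := by
    intro i j hi hij
    by_contra hc
    exact hω ⟨i, j, hi, hij, by simpa [← h.netDegree_eq] using hc⟩
  have hiff : ∀ j, netDegree A i ω ≤ netDegree A j ω ↔ j ≤ i := by
    intro j
    constructor
    · intro hle
      by_contra hc
      exact absurd (hlt i j hi (not_le.1 hc)) (not_lt.2 hle)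
    · intro hle
      rcases hle.eq_or_lt with rfl | hlt'
      · exact le_rfl
      · exact (hlt j i (lt_trans hlt' hi) hlt').le
  simp only [degreeRank, hiff]
  rw [← Finset.card_filter]
  have : Finset.filter (fun j => j ≤ i) Finset.univ = Finset.Iic i := by ext; simp
  rw [this, Fin.card_Iic]

variable [∀ r, IsProbabilityMeasure (edgeLaw r)] [IsProbabilityMeasure P]

/-- Unconditionally, the edge counts are a mixture of the conditional laws. -/
lemma measure_preimage (h : IsOrderedNetwork edgeLaw P W A) (hW : ∀ i, Measurable (W i))
    (S : Set (NodePair n → ℕ)) :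
    P {ω | (fun p : NodePair n => A p.1.1 p.1.2 ω) ∈ S} =
      ∫⁻ ω, netLaw edgeLaw (decOrder fun l => W l ω) S ∂P := by
  set w : Ω → Fin n → ℝ := fun ω => decOrder fun l => W l ω with hw
  have hwm : Measurable w := measurable_decOrder.comp (measurable_pi_lambda _ hW)
  set E : Ω → NodePair n → ℕ := fun ω p => A p.1.1 p.1.2 ω with hE
  have hEm : Measurable E := measurable_pi_lambda _ fun p => h.measurable _ _
  -- The edge counts live in a countable space, so point masses suffice, and `condLaw` gives those.
  -- Measurability in `ω` is inherited almost everywhere from the conditional expectation, as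
  -- `edgeLaw` need not depend measurably on the rate.
  have key : ∀ a : NodePair n → ℕ, AEMeasurable (fun ω => netLaw edgeLaw (w ω) {a}) P ∧
      P (E ⁻¹' {a}) = ∫⁻ ω, netLaw edgeLaw (w ω) {a} ∂P := by
    intro a
    let a' : Fin n → Fin n → ℕ := fun i j => a (nodePair i j)
    have hset : {ω | ∀ i j, i ≤ j → A i j ω = a' i j} = E ⁻¹' {a} := by
      ext ω
      simp only [Set.mem_ofPred_eq, Set.mem_preimage, Set.mem_singleton_iff, funext_iff, hE, a']
      constructor
      · rintro hh ⟨⟨i, j⟩, hij⟩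
        rw [hh i j hij]; simp only at hij; simp [nodePair, hij]
      · intro hh i j hij
        rw [hh ⟨(i, j), hij⟩]; simp [nodePair, hij]
    have hf : ∀ ω, netLaw edgeLaw (w ω) {a} = ENNReal.ofReal (∏ i, ∏ j ∈ Finset.Ici i,
        (edgeLaw (edgeRate (w ω) i j)).real {a' i j}) := by
      intro ω
      rw [netLaw, Measure.pi_singleton]
      have e1 : ∀ p : NodePair n, edgeLaw (edgeRate (w ω) p.1.1 p.1.2) {a p} =
          ENNReal.ofReal ((edgeLaw (edgeRate (w ω) p.1.1 p.1.2)).real {a' p.1.1 p.1.2}) := by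
        rintro ⟨⟨i, j⟩, hij⟩
        simp only at hij
        simp [a', nodePair, hij]
      rw [Finset.prod_congr rfl fun p _ => e1 p,
        ← ENNReal.ofReal_prod_of_nonneg fun _ _ => measureReal_nonneg]
      congr 1
      rw [Finset.prod_sigma']
      refine Finset.prod_bij' (fun p _ => ⟨p.1.1, p.1.2⟩)
        (fun q hq => ⟨(q.1, q.2), by simpa using hq⟩) ?_ ?_ ?_ ?_ ?_
      · rintro ⟨⟨i, j⟩, hij⟩ _; simpa using hij
      all_goals simp
    have hc := h.condLaw a'
    rw [hset] at hc
    have hmeas := hEm (MeasurableSet.singleton a)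
    have hi := integral_condExp_indicator (μ := P) hwm hmeas
    rw [integral_congr_ae hc] at hi
    have hint : Integrable (fun ω => ∏ i, ∏ j ∈ Finset.Ici i,
        (edgeLaw (edgeRate (w ω) i j)).real {a' i j}) P := integrable_condExp.congr hc
    refine ⟨?_, ?_⟩
    · simp_rw [hf]
      exact hint.aestronglyMeasurable.aemeasurable.ennreal_ofReal
    · simp_rw [hf]
      rw [← ofReal_integral_eq_lintegral_ofReal hint
        (ae_of_all _ fun ω => Finset.prod_nonneg fun i _ => Finset.prod_nonneg fun j _ =>
          measureReal_nonneg)]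
      change _ = ENNReal.ofReal (∫ ω, ∏ i, ∏ j ∈ Finset.Ici i,
        (edgeLaw (edgeRate (decOrder fun l => W l ω) i j)).real {a' i j} ∂P)
      rw [hi]; simp
  have hS : ∀ μ : Measure (NodePair n → ℕ), μ S = ∑' a : S, μ {a.1} := by
    intro μ
    have := measure_biUnion (μ := μ) (f := fun a => {a}) S.to_countable
      (fun a _ b _ hab => by simpa [Function.onFun] using hab) (fun _ _ => .singleton _)
    rwa [Set.biUnion_of_singleton] at this
  calc P (E ⁻¹' S) = P.map E S := (Measure.map_apply hEm (.of_discrete)).symm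
    _ = ∑' a : S, P.map E {a.1} := hS _
    _ = ∑' a : S, ∫⁻ ω, netLaw edgeLaw (w ω) {a.1} ∂P := by
      refine tsum_congr fun a => ?_
      rw [Measure.map_apply hEm (MeasurableSet.singleton _), (key a.1).2]
    _ = _ := by
      rw [← lintegral_tsum fun a : S => (key a.1).1]
      exact lintegral_congr fun ω => (hS _).symm

lemma measure_preimage_le (h : IsOrderedNetwork edgeLaw P W A) (hW : ∀ i, Measurable (W i))
    (S : Set (NodePair n → ℕ)) (G : Set (Fin n → ℝ)) {ε : ENNReal}
    (hG : ∀ w ∈ G, netLaw edgeLaw w S ≤ ε) :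
    P {ω | (fun p : NodePair n => A p.1.1 p.1.2 ω) ∈ S} ≤
      ε + P {ω | decOrder (fun l => W l ω) ∉ G} := by
  rw [h.measure_preimage hW]
  set B := {ω | decOrder (fun l => W l ω) ∉ G} with hB
  -- `G` need not be measurable, so the exceptional set is replaced by a measurable hull of equal
  -- measure.
  calc _ ≤ ∫⁻ ω, (ε + (toMeasurable P B).indicator 1 ω) ∂P := by
        refine lintegral_mono fun ω => ?_
        by_cases hω : ω ∈ B
        · refine le_add_left ?_
          rw [Set.indicator_of_mem (subset_toMeasurable P B hω)]
          exact prob_le_one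
        · exact le_add_right (hG _ (by simpa [hB] using hω))
    _ = ε + P B := by
        rw [lintegral_add_left measurable_const, lintegral_indicator_one (measurableSet_toMeasurable _ _),
          measure_toMeasurable]
        simp

end IsOrderedNetwork

/-! ### The tail quantile function -/

/-- The tail `1 - F` of the law `ν` with distribution function `F`. -/
def tailProb (ν : Measure ℝ) (x : ℝ) : ℝ := 1 - cdf ν x

section Quantile

variable {ν : Measure ℝ}

lemma tailProb_nonneg (x : ℝ) : 0 ≤ tailProb ν x := sub_nonneg.2 (cdf_le_one ν x)

lemma antitone_tailProb : Antitone (tailProb ν) := fun _ _ h =>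
  sub_le_sub_left (monotone_cdf ν h) 1

lemma nonempty_quantileSet {t : ℝ} (ht : 1 < t) :
    {x : ℝ | 1 - 1 / t ≤ cdf ν x}.Nonempty := by
  have : 0 < 1 / t := by positivity
  exact ((tendsto_cdf_atTop ν).eventually (eventually_ge_nhds (by linarith))).exists

lemma le_tailQuantile_of_lt_tailProb {t x : ℝ} (ht : 1 < t)
    (hx : 1 / t < tailProb ν x) : x ≤ tailQuantile ν t := by
  refine le_csInf (nonempty_quantileSet ht) fun y hy => ?_
  simp only [Set.mem_ofPred_eq] at hy
  by_contra hc
  have := monotone_cdf ν (not_le.1 hc).le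
  rw [tailProb] at hx
  linarith

lemma tailProb_le_of_tailQuantile_lt {t x : ℝ} (ht : 1 < t)
    (hx : tailQuantile ν t < x) : tailProb ν x ≤ 1 / t := by
  by_contra hc
  exact absurd (le_tailQuantile_of_lt_tailProb ht (not_le.1 hc)) (not_le.2 hx)

variable [IsProbabilityMeasure ν]

lemma cdf_nonpos_eq_zero (hpos : ν (Set.Iic 0) = 0) {x : ℝ} (hx : x ≤ 0) : cdf ν x = 0 := by
  refine le_antisymm ((monotone_cdf ν hx).trans ?_) (cdf_nonneg ν x)
  rw [cdf_eq_real, measureReal_def, hpos, ENNReal.toReal_zero]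

lemma quantileSet_pos (hpos : ν (Set.Iic 0) = 0) {t x : ℝ} (ht : 1 < t)
    (hx : 1 - 1 / t ≤ cdf ν x) : 0 < x := by
  by_contra hc
  rw [cdf_nonpos_eq_zero hpos (not_lt.1 hc)] at hx
  have : 1 / t < 1 := by rw [div_lt_one (by linarith)]; exact ht
  linarith

lemma bddBelow_quantileSet (hpos : ν (Set.Iic 0) = 0) {t : ℝ} (ht : 1 < t) :
    BddBelow {x : ℝ | 1 - 1 / t ≤ cdf ν x} :=
  ⟨0, fun _ hx => (quantileSet_pos hpos ht hx).le⟩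

lemma tailQuantile_nonneg (hpos : ν (Set.Iic 0) = 0) {t : ℝ} (ht : 1 < t) :
    0 ≤ tailQuantile ν t :=
  le_csInf (nonempty_quantileSet ht) fun _ hx => (quantileSet_pos hpos ht hx).le

lemma tailQuantile_mono (hpos : ν (Set.Iic 0) = 0) {t u : ℝ} (ht : 1 < t) (htu : t ≤ u) :
    tailQuantile ν t ≤ tailQuantile ν u := by
  refine csInf_le_csInf (bddBelow_quantileSet hpos ht)
    (nonempty_quantileSet (ht.trans_le htu)) fun x hx => ?_
  have : 1 / u ≤ 1 / t := one_div_le_one_div_of_le (by linarith) htu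
  simp only [Set.mem_ofPred_eq] at hx ⊢
  linarith

lemma tailQuantile_le_of_tailProb_le (hpos : ν (Set.Iic 0) = 0) {t x : ℝ} (ht : 1 < t)
    (hx : tailProb ν x ≤ 1 / t) : tailQuantile ν t ≤ x :=
  csInf_le (bddBelow_quantileSet hpos ht) (by
    simp only [Set.mem_ofPred_eq, tailProb] at hx ⊢; linarith)

/-- `(1 + δ)^p - 1` is at least of order `δ` on `[0, 1]`. -/
lemma one_add_mul_half_le_rpow {p δ : ℝ} (hp : 0 ≤ p) (hδ : 0 ≤ δ) (hδ1 : δ ≤ 1) :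
    1 + p * (δ / 2) ≤ (1 + δ) ^ p := by
  have h1 : δ / 2 ≤ Real.log (1 + δ) := by
    have := Real.one_sub_inv_le_log_of_pos (x := 1 + δ) (by linarith)
    refine le_trans ?_ this
    have h2 : (1 + δ)⁻¹ ≤ 1 - δ / 2 := by
      rw [inv_le_iff_one_le_mul₀ (by linarith)]; nlinarith
    linarith
  rw [Real.rpow_def_of_pos (by linarith)]
  have := Real.add_one_le_exp (Real.log (1 + δ) * p)
  nlinarith

/-- The constants extracted from the lower bound on the tail quantile function. -/
lemma exists_quantile_constants {α : ℝ} (hα : 0 < α) (hpos : ν (Set.Iic 0) = 0)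
    (hlower : QuantileLower (tailQuantile ν) α) :
    ∃ t₁ : ℝ, 1 < t₁ ∧ 0 < tailQuantile ν t₁ ∧ ∃ c : ℝ, 0 < c ∧ c ≤ 1 ∧
      (∀ δ : ℝ, 0 < δ → δ ≤ 1 → ∀ x y : ℝ, 0 < y → 0 < tailProb ν x →
        tailProb ν x ≤ 1 / (2 * t₁) → (1 + δ) * tailProb ν x < tailProb ν y →
          y ≤ (1 - c * δ) * x) ∧
      ∀ u : ℝ, t₁ ≤ u → ∀ x : ℝ, tailProb ν x ≤ 1 / u → c * u ^ (1 / α) ≤ x := by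
  obtain ⟨t₀, ht₀, η, hη, hη1, h⟩ := hlower
  set p := 1 / α with hp
  have hp0 : 0 < p := by positivity
  set t₁ := max t₀ 2 with ht₁
  have h2 : 2 ≤ t₁ := le_max_right _ _
  have hge : ∀ t, t₁ ≤ t → ∀ x, 1 ≤ x →
      (1 - η) * x ^ p + η ≤ tailQuantile ν (t * x) / tailQuantile ν t := fun t ht x hx =>
    h t ((le_max_left _ _).trans ht) (by linarith) x hx
  -- At `x = 1` the lower bound reads `1 ≤ U t / U t`, which fails for `U t = 0` because division by
  -- zero gives 0.
  have hUpos : ∀ t, t₁ ≤ t → 0 < tailQuantile ν t := by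
    intro t ht
    refine (tailQuantile_nonneg hpos (by linarith)).lt_of_ne fun h0 => ?_
    have := hge t ht 1 le_rfl
    rw [← h0, div_zero, Real.one_rpow] at this
    linarith
  have hU : ∀ t, t₁ ≤ t → ∀ x, 1 ≤ x →
      ((1 - η) * x ^ p + η) * tailQuantile ν t ≤ tailQuantile ν (t * x) := fun t ht x hx =>
    (le_div_iff₀ (hUpos t ht)).1 (hge t ht x hx)
  -- `a` is a slope with `(1 - η) (1 + δ)^p + η ≥ 1 + a δ` on `[0, 1]`, and `c₁` satisfies `1 / (1 +
  -- a δ) ≤ 1 - c₁ δ` there.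
  set a := (1 - η) * (p / 2) with ha
  have ha0 : 0 < a := mul_pos (by linarith) (by positivity)
  set c₁ := a / (1 + a) with hc₁
  have hc₁0 : 0 < c₁ := by positivity
  have hc₁1 : c₁ ≤ 1 := by rw [hc₁, div_le_one (by linarith)]; linarith
  set c₂ := (1 - η) * tailQuantile ν t₁ / t₁ ^ p with hc₂
  have hc₂0 : 0 < c₂ := by
    have := hUpos t₁ le_rfl
    have : 0 < 1 - η := by linarith
    positivity
  refine ⟨t₁, by linarith, hUpos _ le_rfl, min c₁ c₂, lt_min hc₁0 hc₂0,
    (min_le_left _ _).trans hc₁1, ?_, ?_⟩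
  · intro δ hδ hδ1 x y hy hx0 hx hxy
    -- Chosen so that `y ≤ U t` while `U (t (1 + δ)) ≤ x`. Since `1 + δ ≤ 2`, the bound `1 / (2 t₁)`
    -- on the tail of `x` forces `t ≥ t₁`.
    set t := 1 / ((1 + δ) * tailProb ν x) with ht
    have hd : 0 < (1 + δ) * tailProb ν x := by positivity
    have htt : t₁ ≤ t := by
      rw [ht, le_div_iff₀ hd]
      rw [le_div_iff₀ (by positivity)] at hx
      nlinarith [mul_nonneg hx0.le (by linarith : 0 ≤ t₁)]
    have h1t : 1 / t = (1 + δ) * tailProb ν x := by rw [ht, one_div_one_div]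
    have hyU : y ≤ tailQuantile ν t :=
      le_tailQuantile_of_lt_tailProb (by linarith) (by rw [h1t]; exact hxy)
    have hUx : tailQuantile ν (t * (1 + δ)) ≤ x := by
      refine tailQuantile_le_of_tailProb_le hpos (by nlinarith) (le_of_eq ?_)
      rw [ht]; field_simp
    have hxU := (hU t htt (1 + δ) (by linarith)).trans hUx
    have h3 := one_add_mul_half_le_rpow hp0.le hδ.le hδ1
    have h4 : 1 + a * δ ≤ (1 - η) * (1 + δ) ^ p + η := by
      have := mul_le_mul_of_nonneg_left h3 (by linarith : 0 ≤ 1 - η)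
      rw [ha]; nlinarith
    have h5 : (1 + a * δ) * y ≤ x :=
      (mul_le_mul h4 hyU hy.le (by nlinarith)).trans hxU
    have hx00 : 0 < x := lt_of_lt_of_le (by positivity) h5
    have h6 : y ≤ (1 - c₁ * δ) * x := by
      have e : 1 ≤ (1 - c₁ * δ) * (1 + a * δ) := by
        have : c₁ * (1 + a) = a := by rw [hc₁]; field_simp
        have h7 : c₁ * δ * (1 + a * δ) ≤ a * δ := by
          calc c₁ * δ * (1 + a * δ) ≤ c₁ * δ * (1 + a) := by gcongr; nlinarith
            _ = c₁ * (1 + a) * δ := by ring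
            _ = a * δ := by rw [this]
        nlinarith
      have hn : 0 ≤ 1 - c₁ * δ := by nlinarith
      calc y ≤ (1 - c₁ * δ) * (1 + a * δ) * y := le_mul_of_one_le_left hy.le e
        _ = (1 - c₁ * δ) * ((1 + a * δ) * y) := by ring
        _ ≤ _ := by gcongr
    refine h6.trans ?_
    have := min_le_left c₁ c₂
    gcongr
  · intro u hu x hx
    have h1 := tailQuantile_le_of_tailProb_le hpos (by linarith) hx
    have h3 := hU t₁ le_rfl (u / t₁) (by rw [le_div_iff₀ (by linarith)]; linarith)
    rw [mul_div_cancel₀ _ (by linarith : t₁ ≠ 0)] at h3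
    have hu0 : 0 < u := by linarith
    calc min c₁ c₂ * u ^ p ≤ c₂ * u ^ p := by gcongr; exact min_le_right _ _
      _ = (1 - η) * (u / t₁) ^ p * tailQuantile ν t₁ := by
        rw [Real.div_rpow hu0.le (by linarith), hc₂]; ring
      _ ≤ ((1 - η) * (u / t₁) ^ p + η) * tailQuantile ν t₁ := by
        have := hUpos t₁ le_rfl
        gcongr; linarith
      _ ≤ x := h3.trans h1

/-- For `α > 2` the square of the tail quantile function grows sublinearly. -/
lemma tendsto_tailQuantile_sq_div {α : ℝ} (hα : 2 < α) (hpos : ν (Set.Iic 0) = 0)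
    (hrv : QuantileRegVar (tailQuantile ν) α) :
    Tendsto (fun t => tailQuantile ν t ^ 2 / t) atTop (𝓝 0) := by
  -- Doubling `t` multiplies `U t ^ 2 / t` by a factor tending to `2^(2/α) / 2 < 1`. This gives
  -- geometric decay along `2^m t₁`; monotonicity of `U` fills the gaps at the cost of a factor 2.
  have h2 := ((hrv 2 two_pos).pow 2).div_const 2
  set ρ₀ : ℝ := (2 ^ (1 / α)) ^ 2 / 2
  have hρ₀ : ρ₀ < 1 := by
    have : ((2 : ℝ) ^ (1 / α)) ^ 2 < 2 := by
      rw [← Real.rpow_natCast, ← Real.rpow_mul two_pos.le]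
      calc (2 : ℝ) ^ (1 / α * (2 : ℕ)) < 2 ^ (1 : ℝ) := by
            apply Real.rpow_lt_rpow_of_exponent_lt one_lt_two
            push_cast
            rw [div_mul_eq_mul_div, div_lt_one (by linarith)]; linarith
        _ = 2 := Real.rpow_one 2
    simp only [ρ₀]; linarith
  obtain ⟨ρ, hρ1, hρ2⟩ := exists_between hρ₀
  have hρpos : 0 < ρ := lt_of_le_of_lt (by positivity) hρ1
  set U := tailQuantile ν with hUdef
  have hU0 : ∀ t, 1 < t → 0 ≤ U t := fun t ht => tailQuantile_nonneg hpos ht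
  -- A quotient above `1/2` excludes `U t = 0`, where it would be 0 by convention.
  have hr1 : ∀ᶠ t in atTop, 1 / 2 < U (t * 1) / U t := by
    have := hrv 1 one_pos
    rw [Real.one_rpow] at this
    exact this.eventually (eventually_gt_nhds (by norm_num))
  obtain ⟨t₁, ht₁⟩ := eventually_atTop.1 ((h2.eventually (eventually_lt_nhds hρ1)).and
    (hr1.and (eventually_gt_atTop 1)))
  have hstep : ∀ t, t₁ ≤ t → U (2 * t) ^ 2 / (2 * t) ≤ ρ * (U t ^ 2 / t) := by
    intro t ht
    obtain ⟨ha, hb, hc⟩ := ht₁ t ht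
    have hUt : 0 < U t := (hU0 t hc).lt_of_ne fun h0 => by
      rw [← h0] at hb; norm_num at hb
    rw [mul_comm t 2, div_pow, div_div, div_lt_iff₀ (by positivity)] at ha
    rw [div_le_iff₀ (by positivity)]
    have : ρ * (U t ^ 2 / t) * (2 * t) = ρ * (U t ^ 2 * 2) := by
      field_simp
    rw [this]; exact ha.le
  have ht₁1 : 1 < t₁ := (ht₁ t₁ le_rfl).2.2
  set g₁ := U t₁ ^ 2 / t₁ with hg₁
  have hiter : ∀ m : ℕ, U (2 ^ m * t₁) ^ 2 / (2 ^ m * t₁) ≤ ρ ^ m * g₁ := by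
    intro m
    induction m with
    | zero => simp [hg₁]
    | succ m ih =>
      have h1 : t₁ ≤ 2 ^ m * t₁ := le_mul_of_one_le_left (by linarith) (one_le_pow₀ one_le_two)
      have := hstep _ h1
      rw [pow_succ' (2 : ℝ) m, mul_assoc, pow_succ' ρ, mul_assoc]
      exact this.trans (mul_le_mul_of_nonneg_left ih hρpos.le)
  rw [Metric.tendsto_atTop]
  intro ε hε
  have hlim : Tendsto (fun m : ℕ => 2 * (ρ ^ (m + 1) * g₁)) atTop (𝓝 0) := by
    have := ((tendsto_pow_atTop_nhds_zero_of_lt_one hρpos.le hρ2).comp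
      (tendsto_add_atTop_nat 1)).mul_const g₁ |>.const_mul 2
    simpa using this
  obtain ⟨M, hM⟩ := eventually_atTop.1 (hlim.eventually (eventually_lt_nhds hε))
  refine ⟨2 ^ M * t₁, fun t ht => ?_⟩
  have htt : 1 ≤ t / t₁ := by
    rw [le_div_iff₀ (by linarith)]
    have : t₁ ≤ 2 ^ M * t₁ := le_mul_of_one_le_left (by linarith) (one_le_pow₀ one_le_two)
    linarith
  obtain ⟨m, hm1, hm2⟩ := exists_nat_pow_near htt one_lt_two
  rw [le_div_iff₀ (by linarith)] at hm1
  rw [div_lt_iff₀ (by linarith)] at hm2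
  have hMm : M ≤ m := by
    by_contra hc
    have h1 : m + 1 ≤ M := by omega
    have : (2 : ℝ) ^ (m + 1) ≤ 2 ^ M := pow_le_pow_right₀ one_le_two h1
    nlinarith
  have hp1 : (1 : ℝ) ≤ 2 ^ m := one_le_pow₀ one_le_two
  have ht0 : 1 < t := by nlinarith
  have hmono : U t ≤ U (2 ^ (m + 1) * t₁) := tailQuantile_mono hpos ht0 hm2.le
  rw [dist_zero_right, Real.norm_of_nonneg (by positivity)]
  calc U t ^ 2 / t ≤ U (2 ^ (m + 1) * t₁) ^ 2 / (2 ^ m * t₁) := by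
        have := hU0 t ht0
        gcongr
    _ = 2 * (U (2 ^ (m + 1) * t₁) ^ 2 / (2 ^ (m + 1) * t₁)) := by
        generalize U (2 ^ (m + 1) * t₁) = z
        rw [pow_succ]; field_simp; ring
    _ ≤ 2 * (ρ ^ (m + 1) * g₁) := by
        have := hiter (m + 1)
        gcongr
    _ < ε := hM m hMm

end Quantile

/-! ### Uniformity of the transformed weights -/

section TailTransform

variable {ν : Measure ℝ}

lemma measurable_tailProb : Measurable (tailProb ν) := antitone_tailProb.measurable

lemma exists_tailProb_eq (hcont : Continuous (cdf ν)) {u : ℝ} (hu : 0 < u) (hu1 : u < 1) :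
    ∃ x, tailProb ν x = u := by
  obtain ⟨x, hx⟩ := mem_range_of_exists_le_of_exists_ge hcont (c := 1 - u)
    (((tendsto_cdf_atBot ν).eventually (eventually_le_nhds (by linarith))).exists)
    (((tendsto_cdf_atTop ν).eventually (eventually_ge_nhds (by linarith))).exists)
  exact ⟨x, by rw [tailProb, hx]; ring⟩

variable [IsProbabilityMeasure ν]

lemma tailProb_eq_real_Ioi (x : ℝ) : tailProb ν x = ν.real (Set.Ioi x) := by
  rw [tailProb, cdf_eq_real, ← Set.compl_Iic, probReal_compl_eq_one_sub measurableSet_Iic]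

/-- For `u < u' < 1`, continuity gives `x` of tail `u'`, and every point of tail at most `u` lies
beyond `x`. Approaching from above covers `u = 0`, a tail value that need not be attained. -/
lemma measureReal_tailProb_le_le (hcont : Continuous (cdf ν)) {u : ℝ} (hu : 0 ≤ u) :
    ν.real {x | tailProb ν x ≤ u} ≤ u := by
  rcases le_or_gt 1 u with h1 | h1
  · exact measureReal_le_one.trans h1
  refine le_of_forall_gt_imp_ge_of_dense fun u' hu' => ?_
  rcases le_or_gt 1 u' with h2 | h2
  · exact measureReal_le_one.trans h2
  obtain ⟨x, hx⟩ := exists_tailProb_eq hcont (hu.trans_lt hu') h2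
  refine (measureReal_mono fun y hy => ?_).trans_eq ((tailProb_eq_real_Ioi x).symm.trans hx)
  by_contra hc
  exact absurd (antitone_tailProb (ν := ν) (not_lt.1 hc)) (by
    simp only [Set.mem_ofPred_eq] at hy; linarith)

lemma le_measureReal_tailProb_lt (hcont : Continuous (cdf ν)) {u : ℝ} (hu1 : u ≤ 1) :
    u ≤ ν.real {x | tailProb ν x < u} := by
  refine le_of_forall_lt_imp_le_of_dense fun u' hu' => ?_
  rcases le_or_gt u' 0 with h2 | h2
  · exact h2.trans measureReal_nonneg
  obtain ⟨x, hx⟩ := exists_tailProb_eq hcont h2 (hu'.trans_le hu1)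
  rw [← hx, tailProb_eq_real_Ioi]
  refine measureReal_mono fun y hy => ?_
  have := antitone_tailProb (ν := ν) (le_of_lt hy)
  simp only [Set.mem_ofPred_eq]; linarith

lemma measureReal_tailProb_le (hcont : Continuous (cdf ν)) {u : ℝ} (hu : 0 ≤ u) (hu1 : u ≤ 1) :
    ν.real {x | tailProb ν x ≤ u} = u :=
  le_antisymm (measureReal_tailProb_le_le hcont hu) ((le_measureReal_tailProb_lt hcont hu1).trans
    (measureReal_mono (Set.ofPred_subset_ofPred.2 fun _ hx => hx.le)))

lemma measureReal_tailProb_mem_Icc_le (hcont : Continuous (cdf ν)) {u v : ℝ} (hu1 : u ≤ 1)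
    (hu : 0 ≤ u) (huv : u ≤ v) : ν.real {x | u ≤ tailProb ν x ∧ tailProb ν x ≤ v} ≤ v - u := by
  have hsub : {x | tailProb ν x < u} ⊆ {x | tailProb ν x ≤ v} := fun x hx => by
    simp only [Set.mem_ofPred_eq] at hx ⊢; linarith
  have e : {x | u ≤ tailProb ν x ∧ tailProb ν x ≤ v} =
      {x | tailProb ν x ≤ v} \ {x | tailProb ν x < u} := by
    ext x; simp [and_comm]
  rw [e, measureReal_sdiff hsub (measurableSet_lt measurable_tailProb measurable_const)]
  linarith [measureReal_tailProb_le_le hcont (hu.trans huv), le_measureReal_tailProb_lt hcont hu1]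

end TailTransform

/-! ### Separation of the largest weights -/

/-- A sample whose largest `k` points have tail probability at most `v`, and in which the points
of tail probability at most `v` are separated from all lower ones by a factor `1 + δ` on the
scale of tail probabilities. -/
structure SeparatedTop (ν : Measure ℝ) {n : ℕ} (k : ℕ) (δ v : ℝ) (x : Fin n → ℝ) : Prop where
  pos : ∀ a, 0 < x a
  tail_pos : ∀ a, 0 < tailProb ν (x a)
  sep : ∀ a b, a ≠ b → tailProb ν (x a) ≤ v → tailProb ν (x a) ≤ tailProb ν (x b) →
    (1 + δ) * tailProb ν (x a) < tailProb ν (x b)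
  count : k ≤ {a | tailProb ν (x a) ≤ v}.ncard

namespace IsIIDWeights

variable {ν : Measure ℝ} {Ω : Type*} [MeasurableSpace Ω] {n : ℕ} {P : Measure Ω} {W : Fin n → Ω → ℝ}

lemma measurePreserving (h : IsIIDWeights P ν W) (a : Fin n) : MeasurePreserving (W a) P ν :=
  ⟨h.measurable a, h.law a⟩

lemma measureReal_preimage (h : IsIIDWeights P ν W) (a : Fin n) {s : Set ℝ}
    (hs : MeasurableSet s) : P.real (W a ⁻¹' s) = ν.real s := by
  rw [measureReal_def, (h.measurePreserving a).measure_preimage hs.nullMeasurableSet,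
    measureReal_def]

variable [IsProbabilityMeasure ν]

lemma measureReal_exists_tailProb_le (h : IsIIDWeights P ν W) (hcont : Continuous (cdf ν)) {u : ℝ}
    (hu : 0 ≤ u) : P.real {ω | ∃ a, tailProb ν (W a ω) ≤ u} ≤ n * u := by
  have e : {ω | ∃ a, tailProb ν (W a ω) ≤ u} = ⋃ a, W a ⁻¹' {x | tailProb ν x ≤ u} := by
    ext; simp
  rw [e]
  refine (measureReal_iUnion_fintype_le _).trans ?_
  calc _ ≤ ∑ _a : Fin n, u := Finset.sum_le_sum fun a _ => by
        rw [h.measureReal_preimage a (measurableSet_le measurable_tailProb measurable_const)]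
        exact measureReal_tailProb_le_le hcont hu
    _ = n * u := by simp

variable [IsProbabilityMeasure P]

lemma measureReal_count_le (h : IsIIDWeights P ν W) (hcont : Continuous (cdf ν)) {v : ℝ}
    (hv : 0 ≤ v) (hv1 : v ≤ 1) :
    P.real {ω | ({a | tailProb ν (W a ω) ≤ v}.ncard : ℝ) ≤ n * v / 4} ≤
      Real.exp (-(n * v / 8)) := by
  classical
  set B := {x | tailProb ν x ≤ v} with hB
  have hBm : MeasurableSet B := measurableSet_le measurable_tailProb measurable_const
  have hg : Measurable (B.indicator (1 : ℝ → ℝ)) := measurable_one.indicator hBm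
  have hind : iIndepFun (fun a => B.indicator (1 : ℝ → ℝ) ∘ W a) P :=
    h.indep.comp (fun _ => B.indicator (1 : ℝ → ℝ)) fun _ => hg
  have hsub := HasSubPoissonMGF.sum hind (fun a => hg.comp (h.measurable a)) fun a =>
    HasSubPoissonMGF.of_map (h.measurePreserving a) hg (HasSubPoissonMGF.indicator hBm)
  have hr : ∑ _a : Fin n, ν.real B = n * v := by
    rw [hB, measureReal_tailProb_le hcont hv hv1]; simp
  rw [hr] at hsub
  have hcount : ∀ ω, ∑ a, (B.indicator (1 : ℝ → ℝ) ∘ W a) ω =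
      ({a | tailProb ν (W a ω) ≤ v}.ncard : ℝ) := by
    intro ω
    rw [Set.ncard_eq_toFinset_card']
    simp [hB, Set.indicator_apply, Finset.sum_boole, Set.toFinset_ofPred]
  -- The exponent is `n v (-1/2 + 1/4) + n v / 8 = -n v / 8`.
  have := hsub.measure_le_le (by positivity) (t := 1 / 2) (by norm_num) (by norm_num) (n * v / 4)
  simp only [hcount] at this
  refine this.trans (le_of_eq ?_)
  congr 1; ring

/-- By Fubini: given `W a = x` with tail at most `v`, the uniform variable `tailProb ν (W b)` must
fall in an interval of length at most `δ v`, and such `x` have probability at most `v`. -/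
lemma measureReal_close_pair_le (h : IsIIDWeights P ν W) (hcont : Continuous (cdf ν)) {δ v : ℝ}
    (hδ : 0 ≤ δ) (hv : 0 ≤ v) {a b : Fin n} (hab : a ≠ b) :
    P.real {ω | tailProb ν (W a ω) ≤ v ∧ tailProb ν (W a ω) ≤ tailProb ν (W b ω) ∧
      tailProb ν (W b ω) ≤ (1 + δ) * tailProb ν (W a ω)} ≤ δ * v ^ 2 := by
  have hT := measurable_tailProb (ν := ν)
  set s : Set (ℝ × ℝ) := {p | tailProb ν p.1 ≤ v ∧ tailProb ν p.1 ≤ tailProb ν p.2 ∧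
    tailProb ν p.2 ≤ (1 + δ) * tailProb ν p.1} with hs
  have hsm : MeasurableSet s := by
    have e : s = {p | tailProb ν p.1 ≤ v} ∩ ({p | tailProb ν p.1 ≤ tailProb ν p.2} ∩
        {p | tailProb ν p.2 ≤ (1 + δ) * tailProb ν p.1}) := by ext; simp [hs]
    rw [e]
    exact (measurableSet_le (by fun_prop) (by fun_prop)).inter
      ((measurableSet_le (by fun_prop) (by fun_prop)).inter
        (measurableSet_le (by fun_prop) (by fun_prop)))
  have hmap : P.map (fun ω => (W a ω, W b ω)) = ν.prod ν := by
    rw [(indepFun_iff_map_prod_eq_prod_map_map (h.measurable a).aemeasurable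
      (h.measurable b).aemeasurable).1 (h.indep.indepFun hab), h.law, h.law]
  have hP : P {ω | tailProb ν (W a ω) ≤ v ∧ tailProb ν (W a ω) ≤ tailProb ν (W b ω) ∧
      tailProb ν (W b ω) ≤ (1 + δ) * tailProb ν (W a ω)} = (ν.prod ν) s := by
    rw [← hmap, Measure.map_apply ((h.measurable a).prodMk (h.measurable b)) hsm]
    rfl
  rw [measureReal_def, hP, Measure.prod_apply hsm]
  refine ENNReal.toReal_le_of_le_ofReal (by positivity) ?_
  have hB : MeasurableSet {x | tailProb ν x ≤ v} := measurableSet_le hT measurable_const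
  calc ∫⁻ x, ν (Prod.mk x ⁻¹' s) ∂ν
      ≤ ∫⁻ x, {x | tailProb ν x ≤ v}.indicator (fun _ => ENNReal.ofReal (δ * v)) x ∂ν := by
        refine lintegral_mono fun x => ?_
        by_cases hx : tailProb ν x ≤ v
        · rw [Set.indicator_of_mem (by exact hx)]
          have h0 := tailProb_nonneg (ν := ν) x
          have h1 : tailProb ν x ≤ 1 := sub_le_self _ (cdf_nonneg ν x)
          have h2 := measureReal_tailProb_mem_Icc_le hcont h1 h0
            (v := (1 + δ) * tailProb ν x) (by nlinarith)
          have h3 : Prod.mk x ⁻¹' s ⊆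
              {y | tailProb ν x ≤ tailProb ν y ∧ tailProb ν y ≤ (1 + δ) * tailProb ν x} :=
            fun y hy => hy.2
          refine (measure_mono h3).trans ?_
          rw [← ofReal_measureReal]
          exact ENNReal.ofReal_le_ofReal (h2.trans (by nlinarith))
        · have : Prod.mk x ⁻¹' s = ∅ := by
            ext y; simp only [hs, Set.mem_preimage, Set.mem_ofPred_eq]; simp [hx]
          rw [this]; simp
    _ = ENNReal.ofReal (δ * v) * ν {x | tailProb ν x ≤ v} := lintegral_indicator_const hB _
    _ ≤ ENNReal.ofReal (δ * v) * ENNReal.ofReal v := by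
        gcongr
        rw [← ofReal_measureReal]
        exact ENNReal.ofReal_le_ofReal (measureReal_tailProb_le_le hcont hv)
    _ = ENNReal.ofReal (δ * v ^ 2) := by
        rw [← ENNReal.ofReal_mul (by positivity)]; congr 1; ring

lemma measureReal_not_separatedTop_le (h : IsIIDWeights P ν W) (hpos : ν (Set.Iic 0) = 0)
    (hcont : Continuous (cdf ν)) {k : ℕ} {δ v : ℝ} (hδ : 0 ≤ δ) (hv : 0 ≤ v) (hv1 : v ≤ 1)
    (hk : (k : ℝ) ≤ n * v / 4) :
    P.real {ω | ¬ SeparatedTop ν k δ v (fun a => W a ω)} ≤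
      n ^ 2 * (δ * v ^ 2) + Real.exp (-(n * v / 8)) := by
  set B₁ := {ω | ∃ a, W a ω ≤ 0}
  set B₂ := {ω | ∃ a, tailProb ν (W a ω) ≤ 0}
  set C : Fin n × Fin n → Set Ω := fun p => {ω | p.1 ≠ p.2 ∧ tailProb ν (W p.1 ω) ≤ v ∧
    tailProb ν (W p.1 ω) ≤ tailProb ν (W p.2 ω) ∧
      tailProb ν (W p.2 ω) ≤ (1 + δ) * tailProb ν (W p.1 ω)} with hC
  set D := {ω | ({a | tailProb ν (W a ω) ≤ v}.ncard : ℝ) ≤ n * v / 4}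
  have hsub : {ω | ¬ SeparatedTop ν k δ v (fun a => W a ω)} ⊆ B₁ ∪ (B₂ ∪ ((⋃ p, C p) ∪ D)) := by
    intro ω hω
    by_contra hc
    simp only [Set.mem_union, not_or, B₁, B₂, D, Set.mem_ofPred_eq, not_exists, not_le,
      Set.mem_iUnion] at hc
    obtain ⟨h1, h2, h3, h4⟩ := hc
    refine hω ⟨h1, h2, fun a b hab hav hle => ?_, ?_⟩
    · by_contra hlt
      exact h3 (a, b) ⟨hab, hav, hle, not_lt.1 hlt⟩
    · exact_mod_cast hk.trans h4.le
  have hB₁ : P.real B₁ = 0 := by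
    have e : B₁ = ⋃ a, W a ⁻¹' Set.Iic 0 := by ext; simp [B₁]
    rw [measureReal_eq_zero_iff, e, measure_iUnion_null_iff]
    intro a
    rw [(h.measurePreserving a).measure_preimage measurableSet_Iic.nullMeasurableSet, hpos]
  have hB₂ : P.real B₂ ≤ 0 := by
    simpa using h.measureReal_exists_tailProb_le hcont le_rfl
  have hCle : P.real (⋃ p, C p) ≤ n ^ 2 * (δ * v ^ 2) := by
    refine (measureReal_iUnion_fintype_le _).trans ?_
    calc ∑ p, P.real (C p) ≤ ∑ _p : Fin n × Fin n, δ * v ^ 2 := by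
          refine Finset.sum_le_sum fun p _ => ?_
          by_cases hp : p.1 = p.2
          · have : C p = ∅ := by ext; simp [hC, hp]
            rw [this, measureReal_empty]; positivity
          · exact (measureReal_mono fun ω hω => hω.2).trans
              (h.measureReal_close_pair_le hcont hδ hv hp)
      _ = _ := by simp [sq]
  have hD := h.measureReal_count_le hcont hv hv1
  have u1 := measureReal_mono (μ := P) hsub
  have u2 := measureReal_union_le (μ := P) B₁ (B₂ ∪ ((⋃ p, C p) ∪ D))
  have u3 := measureReal_union_le (μ := P) B₂ ((⋃ p, C p) ∪ D)
  have u4 := measureReal_union_le (μ := P) (⋃ p, C p) D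
  linarith

end IsIIDWeights

lemma decOrder_antitone {n : ℕ} (x : Fin n → ℝ) : Antitone (decOrder x) := fun _ _ hij =>
  Tuple.monotone_sort x (Fin.rev_le_rev.2 hij)

lemma sum_decOrder {n : ℕ} (x : Fin n → ℝ) : ∑ i, decOrder x i = ∑ a, x a := by
  simp only [decOrder]
  exact (Fin.revPerm.trans (Tuple.sort x)).sum_comp x

/-- Otherwise all points of tail at most `v` would occupy positions before `i`, so there would be at
most `i < k` of them. -/
lemma SeparatedTop.tailProb_decOrder_le {ν : Measure ℝ} {n k : ℕ} {δ v : ℝ} {x : Fin n → ℝ}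
    (h : SeparatedTop ν k δ v x) (i : Fin n) (hi : (i : ℕ) < k) :
    tailProb ν (decOrder x i) ≤ v := by
  by_contra hc
  have hsub : {a | tailProb ν (x a) ≤ v} ⊆
      (fun j : Fin n => Tuple.sort x j.rev) '' (Set.Iio i) := by
    intro a ha
    refine ⟨((Tuple.sort x).symm a).rev, ?_, by simp⟩
    by_contra hlt
    have hle := decOrder_antitone x (not_lt.1 hlt)
    have := antitone_tailProb (ν := ν) hle
    simp only [decOrder, Fin.rev_rev, Equiv.apply_symm_apply] at this hc
    simp only [Set.mem_ofPred_eq] at ha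
    linarith
  have h1 := (Set.ncard_le_ncard hsub).trans (Set.ncard_image_le)
  have h2 : (Set.Iio i).ncard = i := by
    rw [Set.ncard_eq_toFinset_card']; simp
  have := h.count
  omega

lemma SeparatedTop.tailProb_decOrder_lt {ν : Measure ℝ} {n k : ℕ} {δ v : ℝ} {x : Fin n → ℝ}
    (h : SeparatedTop ν k δ v x) {i j : Fin n} (hi : (i : ℕ) < k) (hij : i < j) :
    (1 + δ) * tailProb ν (decOrder x i) < tailProb ν (decOrder x j) := by
  refine h.sep _ _ ?_ (h.tailProb_decOrder_le i hi)
    (antitone_tailProb (decOrder_antitone x hij.le))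
  simpa using hij.ne

/-! ### The finite-`n` bound -/

namespace IsOrderedNetwork

variable {edgeLaw : ℝ → Measure ℕ} [∀ r, IsProbabilityMeasure (edgeLaw r)]
  {Ω : Type*} [MeasurableSpace Ω] {n : ℕ} {P : Measure Ω} [IsProbabilityMeasure P]
  {W : Fin n → Ω → ℝ} {A : Fin n → Fin n → Ω → ℕ} {ν : Measure ℝ} [IsProbabilityMeasure ν]

/-- A bound for the probability that the first `k` nodes are misranked. Here `R` is a set of rates
on which the edge law is sub-Poisson, and `c` is as in `exists_quantile_constants`. -/
lemma measureReal_misranked_le (h : IsOrderedNetwork edgeLaw P W A) (hW : IsIIDWeights P ν W)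
    (hpos : ν (Set.Iic 0) = 0) (hcont : Continuous (cdf ν)) {R : Set ℝ}
    (hR : ∀ r ∈ R, HasSubPoissonMGF (fun m : ℕ => (m : ℝ)) (edgeLaw r) r)
    {k : ℕ} {α c t₁ δ v : ℝ} (hc : 0 < c) (hc1 : c ≤ 1) (ht₁ : 1 < t₁)
    (hgap : ∀ δ : ℝ, 0 < δ → δ ≤ 1 → ∀ x y : ℝ, 0 < y → 0 < tailProb ν x →
      tailProb ν x ≤ 1 / (2 * t₁) → (1 + δ) * tailProb ν x < tailProb ν y → y ≤ (1 - c * δ) * x)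
    (hlow : ∀ u : ℝ, t₁ ≤ u → ∀ x : ℝ, tailProb ν x ≤ 1 / u → c * u ^ (1 / α) ≤ x)
    (hδ : 0 < δ) (hδ1 : δ ≤ 1) (hv : 0 < v) (hv1 : v ≤ 1 / (2 * t₁))
    (hk : (k : ℝ) ≤ n * v / 4) :
    P.real {ω | (fun p : NodePair n => A p.1.1 p.1.2 ω) ∈ misranked n k} ≤
      2 * n ^ 2 * Real.exp (-((c * δ) ^ 2 * (c * (1 / v) ^ (1 / α)) / 16)) +
      (n ^ 2 * (δ * v ^ 2) + Real.exp (-(n * v / 8))) +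
      P.real {ω | (∀ a, 0 < W a ω) ∧ ∃ i j, edgeRate (decOrder fun l => W l ω) i j ∉ R} := by
  have hv2 : v ≤ 1 / t₁ := hv1.trans (one_div_le_one_div_of_le (by linarith) (by linarith))
  have hvone : v ≤ 1 := hv2.trans (by rw [div_le_one (by linarith)]; exact ht₁.le)
  -- Good ordered weights: the Chernoff and union bound applies to each of them with `s = c δ`. A
  -- separated sample with all rates in `R` yields one.
  set G : Set (Fin n → ℝ) := {w | (∀ i, 0 < w i) ∧ (∀ i j, edgeRate w i j ∈ R) ∧
    (∀ i j : Fin n, (i : ℕ) < k → i < j → w j ≤ (1 - c * δ) * w i) ∧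
    ∀ i : Fin n, (i : ℕ) < k → c * (1 / v) ^ (1 / α) ≤ w i} with hG
  set b := 2 * (n : ℝ) ^ 2 * Real.exp (-((c * δ) ^ 2 * (c * (1 / v) ^ (1 / α)) / 16)) with hb
  have hb0 : 0 ≤ b := by positivity
  have h1 := h.measure_preimage_le hW.measurable (misranked n k) G (ε := ENNReal.ofReal b) (by
    rintro w ⟨hw1, hw2, hw3, hw4⟩
    rw [← ofReal_measureReal]
    exact ENNReal.ofReal_le_ofReal (netLaw_misranked_le hw1 (fun i j => hR _ (hw2 i j))
      (by positivity) (mul_le_one₀ hc1 hδ.le hδ1) hw3 hw4))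
  have h2 : P.real {ω | (fun p : NodePair n => A p.1.1 p.1.2 ω) ∈ misranked n k} ≤
      b + P.real {ω | decOrder (fun l => W l ω) ∉ G} := by
    have := ENNReal.toReal_mono (by finiteness) h1
    rwa [ENNReal.toReal_add (by finiteness) (by finiteness), ENNReal.toReal_ofReal hb0] at this
  have hsub : {ω | decOrder (fun l => W l ω) ∉ G} ⊆
      {ω | ¬ SeparatedTop ν k δ v (fun a => W a ω)} ∪
      {ω | (∀ a, 0 < W a ω) ∧ ∃ i j, edgeRate (decOrder fun l => W l ω) i j ∉ R} := by
    intro ω hω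
    by_contra hcon
    simp only [Set.mem_union, Set.mem_ofPred_eq, not_or, not_not, not_and, not_exists] at hcon
    obtain ⟨hs, hr⟩ := hcon
    refine hω ⟨fun i => hs.pos _, hr hs.pos, fun i j hi hij => ?_, fun i hi => ?_⟩
    · exact hgap δ hδ hδ1 _ _ (hs.pos _) (hs.tail_pos _)
        ((hs.tailProb_decOrder_le i hi).trans hv1) (hs.tailProb_decOrder_lt hi hij)
    · refine hlow (1 / v) ?_ _ (by rw [one_div_one_div]; exact hs.tailProb_decOrder_le i hi)
      rw [le_div_iff₀ hv]
      rw [le_div_iff₀ (by linarith)] at hv2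
      linarith
  have h3 := (measureReal_mono (μ := P) hsub).trans (measureReal_union_le _ _)
  have h4 := hW.measureReal_not_separatedTop_le hpos hcont hδ.le hv.le hvone hk
  linarith

end IsOrderedNetwork

/-! ### Consequences of the growth condition on `k` -/

section Asymptotics

variable {α : ℝ} {k : ℕ → ℕ}

lemma tendsto_div_of_rate (hα : 0 < α)
    (hrate : Tendsto (fun n : ℕ => (k n : ℝ) * Real.log n ^ α / (n : ℝ) ^ (1 / (4 * α + 1)))
      atTop (𝓝 0)) :
    Tendsto (fun n : ℕ => (k n : ℝ) / n) atTop (𝓝 0) := by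
  have hlog : ∀ᶠ n : ℕ in atTop, 1 ≤ Real.log n :=
    (Real.tendsto_log_atTop.comp tendsto_natCast_atTop_atTop).eventually (eventually_ge_atTop 1)
  have hβ : 0 < 1 - 1 / (4 * α + 1) := by
    rw [sub_pos, div_lt_one (by linarith)]; linarith
  have hlim : Tendsto (fun n : ℕ => (n : ℝ) ^ (-(1 - 1 / (4 * α + 1)))) atTop (𝓝 0) :=
    (tendsto_rpow_neg_atTop hβ).comp tendsto_natCast_atTop_atTop
  refine tendsto_of_tendsto_of_tendsto_of_le_of_le' tendsto_const_nhds hlim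
    (.of_forall fun n => by positivity) ?_
  filter_upwards [hlog, hrate.eventually (eventually_le_nhds zero_lt_one),
    eventually_gt_atTop 0] with n hl hr hn
  have hn0 : (0 : ℝ) < n := by exact_mod_cast hn
  rw [div_le_one (by positivity)] at hr
  have h1 : (k n : ℝ) ≤ (n : ℝ) ^ (1 / (4 * α + 1)) :=
    (le_mul_of_one_le_right (by positivity) (Real.one_le_rpow hl hα.le)).trans hr
  rw [neg_sub, Real.rpow_sub hn0, Real.rpow_one]
  gcongr

/-- With `q = 4 + 1/α` one has `α q = 4α + 1`, so the `q`-th power of the rate condition compares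
`k^(4 + 1/α) (log n)^(4α + 1)` with `n^(1/α)`. The claim needs only the power `2α + 1` of the
logarithm. -/
lemma eventually_mul_log_le_of_rate (hα : 0 < α) (hk : Tendsto k atTop atTop)
    (hrate : Tendsto (fun n : ℕ => (k n : ℝ) * Real.log n ^ α / (n : ℝ) ^ (1 / (4 * α + 1)))
      atTop (𝓝 0)) {K : ℝ} (hK : 0 < K) :
    ∀ᶠ n : ℕ in atTop, K * Real.log n ≤
      (1 / ((k n : ℝ) ^ 2 * Real.log n ^ α)) ^ 2 * (1 / (4 * k n / n : ℝ)) ^ (1 / α) := by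
  have hlog : ∀ᶠ n : ℕ in atTop, 1 ≤ Real.log n :=
    (Real.tendsto_log_atTop.comp tendsto_natCast_atTop_atTop).eventually (eventually_ge_atTop 1)
  set q : ℝ := 4 + 1 / α with hq
  have hq0 : 0 < q := by positivity
  set K' := K * 4 ^ (1 / α) with hK'
  -- `K'` absorbs the 4 in `4 k / n`; `ε` is chosen so that `ε ^ q` cancels `K'`.
  have hK'0 : 0 < K' := by positivity
  set ε := K' ^ (-(1 / q)) with hε
  have hε0 : 0 < ε := by positivity
  have hεq : ε ^ q = K'⁻¹ := by
    rw [hε, ← Real.rpow_mul hK'0.le, ← Real.rpow_neg_one]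
    congr 1; field_simp
  filter_upwards [hlog, hrate.eventually (eventually_le_nhds hε0), eventually_gt_atTop 0,
    hk.eventually (eventually_gt_atTop 0)] with n hl hr hn hkn
  have hn0 : (0 : ℝ) < n := by exact_mod_cast hn
  have hk0 : (0 : ℝ) < k n := by exact_mod_cast hkn
  set L := Real.log n
  have hL0 : 0 < L := by linarith
  rw [div_le_iff₀ (by positivity)] at hr
  have h1 := Real.rpow_le_rpow (by positivity) hr hq0.le
  rw [Real.mul_rpow (by positivity) (by positivity), Real.mul_rpow (by positivity) (by positivity),
    hεq, ← Real.rpow_mul hL0.le, ← Real.rpow_mul hn0.le,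
    show 1 / (4 * α + 1) * q = 1 / α by rw [hq]; field_simp,
    show α * q = α + α + α + α + 1 by rw [hq]; field_simp; ring, hq, Real.rpow_add hk0,
    Real.rpow_add hL0, Real.rpow_add hL0, Real.rpow_add hL0, Real.rpow_add hL0, Real.rpow_one,
    show ((k n : ℝ)) ^ (4 : ℝ) = (k n : ℝ) ^ (4 : ℕ) by
      rw [← Real.rpow_natCast]; norm_num] at h1
  have hA : 1 ≤ L ^ α := Real.one_le_rpow hl hα.le
  rw [one_div_div, Real.div_rpow hn0.le (by positivity), Real.mul_rpow (by norm_num) hk0.le]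
  set N := (n : ℝ) ^ (1 / α)
  set κ := (k n : ℝ) ^ (1 / α)
  have hκ : 0 < κ := by positivity
  set B := L ^ α
  have hB : 0 < B := by positivity
  set F : ℝ := 4 ^ (1 / α)
  have hF : 0 < F := by positivity
  have h2 : K' * ((k n : ℝ) ^ 4 * κ * (B * B * B * B * L)) ≤ N := by
    have := mul_le_mul_of_nonneg_left h1 hK'0.le
    rwa [← mul_assoc K' K'⁻¹, mul_inv_cancel₀ hK'0.ne', one_mul] at this
  rw [div_pow, one_pow, div_mul_div_comm, one_mul, le_div_iff₀ (by positivity)]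
  refine le_trans ?_ h2
  have hBB : 1 ≤ B * B := by nlinarith
  calc K * L * (((k n : ℝ) ^ 2 * B) ^ 2 * (F * κ))
      = K' * ((k n : ℝ) ^ 4 * κ * (B * B * L)) := by rw [hK']; ring
    _ ≤ K' * ((k n : ℝ) ^ 4 * κ * ((B * B) * (B * B * L))) := by
        gcongr
        exact le_mul_of_one_le_left (by positivity) hBB
    _ = _ := by ring

end Asymptotics

/-! ### Passage to the limit -/

section Family

variable {ν : Measure ℝ} [IsProbabilityMeasure ν] {Ω : ℕ → Type*} [∀ n, MeasurableSpace (Ω n)]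
  {P : ∀ n, Measure (Ω n)} [∀ n, IsProbabilityMeasure (P n)]
  {W : ∀ n, Fin n → Ω n → ℝ} {α : ℝ}

/-- If `α > 2`, all edge rates lie in `[0, 1]` with high probability. -/
lemma eventually_measureReal_edgeRate_notMem_le (hpos : ν (Set.Iic 0) = 0)
    (hcont : Continuous (cdf ν)) (hα : 2 < α) (hrv : QuantileRegVar (tailQuantile ν) α)
    (hlower : QuantileLower (tailQuantile ν) α) (hW : ∀ n, IsIIDWeights (P n) ν (W n))
    {ε : ℝ} (hε : 0 < ε) :
    ∀ᶠ n in atTop, (P n).real {ω | (∀ a, 0 < W n a ω) ∧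
      ∃ i j, edgeRate (decOrder fun l => W n l ω) i j ∉ Set.Icc (0 : ℝ) 1} ≤ ε := by
  obtain ⟨t₁, ht₁, hU, -⟩ := exists_quantile_constants (by linarith) hpos hlower
  -- Some weight exceeds `U (n M)` with probability at most `1 / M = ε / 2`. With high probability
  -- at least `n / (4 t₁)` weights are at least `U t₁`, and `κ n M` is the resulting lower bound for
  -- the total weight; so `U (n M) ^ 2 ≤ κ n M` keeps all rates below 1.
  set M := 2 / ε with hM
  have hM0 : 0 < M := by positivity
  set κ := tailQuantile ν t₁ / (4 * t₁ * M) with hκ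
  have hκ0 : 0 < κ := by
    have : 0 < t₁ := by linarith
    positivity
  have hnM : Tendsto (fun n : ℕ => (n : ℝ) * M) atTop atTop :=
    tendsto_natCast_atTop_atTop.atTop_mul_const hM0
  have hsq := ((tendsto_tailQuantile_sq_div hα hpos hrv).comp hnM).eventually
    (eventually_le_nhds hκ0)
  have hexp : Tendsto (fun n : ℕ => Real.exp (-(n * (1 / t₁) / 8))) atTop (𝓝 0) := by
    refine Real.tendsto_exp_neg_atTop_nhds_zero.comp ?_
    exact (tendsto_natCast_atTop_atTop.atTop_mul_const (by positivity)).atTop_div_const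
      (by norm_num)
  filter_upwards [hsq, hnM.eventually (eventually_gt_atTop 1), eventually_gt_atTop 0,
    hexp.eventually (eventually_le_nhds (half_pos hε))] with n h1 h2 hn h3
  have hn0 : (0 : ℝ) < n := by exact_mod_cast hn
  set V := tailQuantile ν (n * M) with hV
  have hV0 : 0 ≤ V := tailQuantile_nonneg hpos h2
  have hVsq : V ^ 2 ≤ n * (1 / t₁) / 4 * tailQuantile ν t₁ := by
    simp only [Function.comp_apply] at h1
    rw [div_le_iff₀ (by linarith)] at h1
    refine h1.trans (le_of_eq ?_)
    rw [hκ]; field_simp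
  have hsub : {ω | (∀ a, 0 < W n a ω) ∧
      ∃ i j, edgeRate (decOrder fun l => W n l ω) i j ∉ Set.Icc (0 : ℝ) 1} ⊆
      {ω | ∃ a, tailProb ν (W n a ω) ≤ 1 / (n * M)} ∪
      {ω | ({a | tailProb ν (W n a ω) ≤ 1 / t₁}.ncard : ℝ) ≤ n * (1 / t₁) / 4} := by
    rintro ω ⟨hp, i, j, hij⟩
    by_contra hcon
    simp only [Set.mem_union, Set.mem_ofPred_eq, not_or, not_exists, not_le] at hcon
    obtain ⟨hmax, hcount⟩ := hcon
    have hle : ∀ a, W n a ω ≤ V := by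
      intro a
      by_contra hc
      exact absurd (tailProb_le_of_tailQuantile_lt h2 (not_le.1 hc)) (not_le.2 (hmax a))
    set w := decOrder fun l => W n l ω with hw
    have hw0 : ∀ i, 0 < w i := fun i => hp _
    have hwV : ∀ i, w i ≤ V := fun i => hle _
    have hsum : n * (1 / t₁) / 4 * tailQuantile ν t₁ ≤ ∑ l, w l := by
      classical
      rw [hw, sum_decOrder]
      set S := Finset.univ.filter fun a => tailProb ν (W n a ω) ≤ 1 / t₁ with hS
      have hcard : ({a | tailProb ν (W n a ω) ≤ 1 / t₁}.ncard : ℝ) = S.card := by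
        rw [Set.ncard_eq_toFinset_card']; simp [hS, Set.toFinset_ofPred]
      rw [hcard] at hcount
      calc n * (1 / t₁) / 4 * tailQuantile ν t₁ ≤ S.card * tailQuantile ν t₁ := by gcongr
        _ = ∑ _a ∈ S, tailQuantile ν t₁ := by simp
        _ ≤ ∑ a ∈ S, W n a ω := Finset.sum_le_sum fun a ha =>
            tailQuantile_le_of_tailProb_le hpos ht₁ (by simpa [hS] using ha)
        _ ≤ ∑ a, W n a ω := Finset.sum_le_univ_sum_of_nonneg fun a => (hp a).le
    have hL : 0 < ∑ l, w l := Finset.sum_pos (fun l _ => hw0 l) ⟨i, Finset.mem_univ _⟩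
    refine hij ⟨div_nonneg (mul_nonneg (hw0 i).le (hw0 j).le) hL.le, ?_⟩
    rw [edgeRate, div_le_one hL]
    calc w i * w j ≤ V * V := mul_le_mul (hwV i) (hwV j) (hw0 j).le hV0
      _ = V ^ 2 := by ring
      _ ≤ _ := hVsq.trans hsum
  have h4 := (measureReal_mono (μ := P n) hsub).trans (measureReal_union_le _ _)
  have h5 := (hW n).measureReal_exists_tailProb_le hcont (u := 1 / (n * M)) (by positivity)
  have h6 := (hW n).measureReal_count_le hcont (v := 1 / t₁) (by positivity)
    (by rw [div_le_one (by linarith)]; exact ht₁.le)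
  have h7 : (n : ℝ) * (1 / (n * M)) = ε / 2 := by rw [hM]; field_simp
  linarith

lemma tendsto_measureReal_misranked {edgeLaw : ℝ → Measure ℕ}
    [∀ r, IsProbabilityMeasure (edgeLaw r)] (hpos : ν (Set.Iic 0) = 0)
    (hcont : Continuous (cdf ν)) (hα : 0 < α) (hlower : QuantileLower (tailQuantile ν) α)
    (hW : ∀ n, IsIIDWeights (P n) ν (W n)) {A : ∀ n, Fin n → Fin n → Ω n → ℕ}
    (hA : ∀ n, IsOrderedNetwork edgeLaw (P n) (W n) (A n)) {R : Set ℝ}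
    (hR : ∀ r ∈ R, HasSubPoissonMGF (fun m : ℕ => (m : ℝ)) (edgeLaw r) r)
    (hWR : ∀ ε : ℝ, 0 < ε → ∀ᶠ n in atTop, (P n).real {ω | (∀ a, 0 < W n a ω) ∧
      ∃ i j, edgeRate (decOrder fun l => W n l ω) i j ∉ R} ≤ ε)
    {k : ℕ → ℕ} (hk : Tendsto k atTop atTop)
    (hrate : Tendsto (fun n : ℕ => (k n : ℝ) * Real.log n ^ α / (n : ℝ) ^ (1 / (4 * α + 1)))
      atTop (𝓝 0)) :
    Tendsto (fun n => (P n).real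
      {ω | (fun p : NodePair n => A n p.1.1 p.1.2 ω) ∈ misranked n (k n)}) atTop (𝓝 0) := by
  obtain ⟨t₁, ht₁, -, c, hc, hc1, hgap, hlow⟩ := exists_quantile_constants hα hpos hlower
  have hlogt : Tendsto (fun n : ℕ => Real.log n) atTop atTop :=
    Real.tendsto_log_atTop.comp tendsto_natCast_atTop_atTop
  have hkR : Tendsto (fun n => (k n : ℝ)) atTop atTop := tendsto_natCast_atTop_atTop.comp hk
  have hbound : Tendsto (fun n : ℕ => 2 * (1 / (n : ℝ)) + (16 * (1 / Real.log n ^ α) +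
      Real.exp (-(k n / 2 : ℝ)))) atTop (𝓝 0) := by
    have e1 : Tendsto (fun n : ℕ => 2 * (1 / (n : ℝ))) atTop (𝓝 (2 * 0)) :=
      tendsto_one_div_atTop_nhds_zero_nat.const_mul 2
    have e2 : Tendsto (fun n : ℕ => 16 * (1 / Real.log n ^ α)) atTop (𝓝 (16 * 0)) := by
      have := ((tendsto_rpow_atTop hα).comp hlogt).inv_tendsto_atTop
      simp only [one_div]
      exact this.const_mul 16
    have e3 : Tendsto (fun n : ℕ => Real.exp (-(k n / 2 : ℝ))) atTop (𝓝 0) :=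
      Real.tendsto_exp_neg_atTop_nhds_zero.comp (hkR.atTop_div_const two_pos)
    simpa using e1.add (e2.add e3)
  have hv1 : ∀ᶠ n : ℕ in atTop, 4 * ((k n : ℝ) / n) ≤ 1 / (2 * t₁) := by
    have := (tendsto_div_of_rate hα hrate).const_mul 4
    rw [mul_zero] at this
    exact this.eventually (eventually_le_nhds (by positivity))
  -- With this constant the Chernoff exponent, which carries the factor `c ^ 3 / 16`, is at least `3
  -- log n`; the `n ^ 2` pairs then contribute `2 / n`.
  have hK : 0 < 48 / c ^ 3 := by positivity
  rw [Metric.tendsto_nhds]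
  intro ε hε
  filter_upwards [hbound.eventually (eventually_lt_nhds (half_pos hε)), hv1,
    eventually_mul_log_le_of_rate hα hk hrate hK, hlogt.eventually (eventually_ge_atTop 1),
    hk.eventually (eventually_gt_atTop 0), eventually_gt_atTop 0, hWR (ε / 2) (half_pos hε)]
    with n hb hv hlog hl hkn hn hr
  have hn0 : (0 : ℝ) < n := by exact_mod_cast hn
  have hk1 : (1 : ℝ) ≤ k n := by exact_mod_cast hkn
  have hk0 : (0 : ℝ) < k n := by linarith
  have hL : 1 ≤ Real.log n ^ α := Real.one_le_rpow hl hα.le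
  rw [dist_zero_right, Real.norm_of_nonneg measureReal_nonneg]
  rw [← mul_div_assoc] at hv
  -- `v` gives `n v / 4 = k`, as the count of top points requires; `δ` then turns `n ^ 2 δ v ^ 2`
  -- into `16 / log^α n`.
  set δ := 1 / ((k n : ℝ) ^ 2 * Real.log n ^ α) with hδ
  set v := 4 * (k n : ℝ) / n with hv'
  have hδ0 : 0 < δ := by positivity
  have hδ1 : δ ≤ 1 := by
    rw [hδ, div_le_one (by positivity)]
    exact one_le_mul_of_one_le_of_one_le (one_le_pow₀ hk1) hL
  have hv0 : 0 < v := by positivity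
  have hnv : n * v = 4 * k n := by rw [hv']; field_simp
  have hmain := (hA n).measureReal_misranked_le (hW n) hpos hcont hR (k := k n) hc hc1 ht₁ hgap
    hlow hδ0 hδ1 hv0 hv (by rw [hnv]; linarith)
  have f1 : 2 * (n : ℝ) ^ 2 * Real.exp (-((c * δ) ^ 2 * (c * (1 / v) ^ (1 / α)) / 16)) ≤
      2 * (1 / n) := by
    have g1 : 3 * Real.log n ≤ (c * δ) ^ 2 * (c * (1 / v) ^ (1 / α)) / 16 := by
      have := mul_le_mul_of_nonneg_left hlog (by positivity : 0 ≤ c ^ 3 / 16)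
      calc 3 * Real.log n = c ^ 3 / 16 * (48 / c ^ 3 * Real.log n) := by field_simp; norm_num
        _ ≤ _ := this
        _ = _ := by ring
    have g2 : Real.exp (-(3 * Real.log n)) = 1 / (n : ℝ) ^ 3 := by
      rw [Real.exp_neg, show 3 * Real.log n = ((3 : ℕ) : ℝ) * Real.log n by norm_num,
        Real.exp_nat_mul, Real.exp_log hn0, one_div]
    calc _ ≤ 2 * (n : ℝ) ^ 2 * Real.exp (-(3 * Real.log n)) := by gcongr
      _ = 2 * (1 / n) := by rw [g2]; field_simp
  have f2 : (n : ℝ) ^ 2 * (δ * v ^ 2) = 16 * (1 / Real.log n ^ α) := by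
    calc (n : ℝ) ^ 2 * (δ * v ^ 2) = (n * v) ^ 2 * δ := by ring
      _ = _ := by rw [hnv, hδ]; field_simp; norm_num
  have f3 : (n : ℝ) * v / 8 = k n / 2 := by rw [hnv]; ring
  rw [f2, f3] at hmain
  linarith

end Family

end

theorem theorem3p1
    -- the weight law: positively supported, with continuous distribution function
    (ν : Measure ℝ) [IsProbabilityMeasure ν] (hpos : ν (Set.Iic 0) = 0)
    (hcont : Continuous (cdf ν))
    (α : ℝ) (hα : 0 < α)
    (hrv : QuantileRegVar (tailQuantile ν) α)
    (hlower : QuantileLower (tailQuantile ν) α)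
    -- for every `n`, a network on `n` nodes, on its own probability space
    {Ω : ℕ → Type*} [∀ n, MeasurableSpace (Ω n)]
    (P : ∀ n, Measure (Ω n)) [∀ n, IsProbabilityMeasure (P n)]
    (W : ∀ n, Fin n → Ω n → ℝ) (hW : ∀ n, IsIIDWeights (P n) ν (W n))
    (A : ∀ n, Fin n → Fin n → Ω n → ℕ)
    (hA : (∀ n, IsNorrosReittu (P n) (W n) (A n)) ∨
      (2 < α ∧ ∀ n, IsChungLu (P n) (W n) (A n)))
    (k : ℕ → ℕ) (hk : Tendsto k atTop atTop)
    (hk_rate : Tendsto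
      (fun n : ℕ => (k n : ℝ) * Real.log n ^ α / (n : ℝ) ^ (1 / (4 * α + 1))) atTop (𝓝 0)) :
    -- nodes are indexed from 0, ranks from 1
    Tendsto
      (fun n => P n {ω | ∀ i : Fin n, (i : ℕ) < k n → degreeRank (A n) i ω = (i : ℕ) + 1})
      atTop (𝓝 1) := by
  set bad : ∀ n, Set (Ω n) := fun n =>
    {ω | (fun p : NodePair n => A n p.1.1 p.1.2 ω) ∈ misranked n (k n)} with hbad
  have hmain : Tendsto (fun n => (P n).real (bad n)) atTop (𝓝 0) ∧
      ∀ n, (bad n)ᶜ ⊆ {ω | ∀ i : Fin n, (i : ℕ) < k n →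
        degreeRank (A n) i ω = (i : ℕ) + 1} := by
    rcases hA with hA | ⟨hα2, hA⟩
    -- For Poisson edges every nonnegative rate is admissible, and positive weights give no others.
    · refine ⟨tendsto_measureReal_misranked (R := Set.Ici 0) hpos hcont hα hlower hW hA ?_ ?_
        hk hk_rate, fun n ω hω i hi => (hA n).degreeRank_eq hω i hi⟩
      · intro r hr
        exact (hasSubPoissonMGF_poissonMeasure _).mono (Real.coe_toNNReal r hr)
      · refine fun ε hε => .of_forall fun n => ?_
        have : {ω | (∀ a, 0 < W n a ω) ∧
            ∃ i j, edgeRate (decOrder fun l => W n l ω) i j ∉ Set.Ici (0 : ℝ)} = ∅ := by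
          refine Set.eq_empty_of_forall_notMem ?_
          rintro ω ⟨hp, i, j, hij⟩
          exact hij (div_nonneg (mul_nonneg (hp _).le (hp _).le)
            (Finset.sum_nonneg fun l _ => (hp _).le))
        rw [this, measureReal_empty]
        exact hε.le
    -- On `[0, 1]` the Bernoulli parameter equals the rate, so no mean is lost to truncation.
    · refine ⟨tendsto_measureReal_misranked (R := Set.Icc 0 1) hpos hcont hα hlower hW hA ?_
        (fun ε hε => eventually_measureReal_edgeRate_notMem_le hpos hcont hα2 hrv hlower hW hε)
        hk hk_rate, fun n ω hω i hi => (hA n).degreeRank_eq hω i hi⟩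
      intro r hr
      exact (hasSubPoissonMGF_bernoulliMeasure _).mono (by
        rw [Set.projIcc_of_mem zero_le_one hr])
  obtain ⟨hlim, hsub⟩ := hmain
  have hlim' : Tendsto (fun n => 1 - P n (bad n)) atTop (𝓝 1) := by
    have h0 : Tendsto (fun n => P n (bad n)) atTop (𝓝 0) := by
      have := ENNReal.tendsto_ofReal hlim
      simpa [ofReal_measureReal] using this
    simpa using ENNReal.Tendsto.sub tendsto_const_nhds h0 (.inl ENNReal.one_ne_top)
  refine tendsto_of_tendsto_of_tendsto_of_le_of_le hlim' tendsto_const_nhds (fun n => ?_)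
    (fun n => prob_le_one)
  refine tsub_le_iff_right.2 ?_
  have hu : (Set.univ : Set (Ω n)) ⊆ {ω | ∀ i : Fin n, (i : ℕ) < k n →
      degreeRank (A n) i ω = (i : ℕ) + 1} ∪ bad n := by
    intro ω _
    by_cases hω : ω ∈ bad n
    · exact Or.inr hω
    · exact Or.inl (hsub n hω)
  calc (1 : ENNReal) = P n Set.univ := measure_univ.symm
    _ ≤ _ := (measure_mono hu).trans (measure_union_le _ _)
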